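/- Let $d\ge 1$ be an integer, let $1<p<2$, and let $p'$ be the conjugate exponent, $\frac1p+\frac1{p'}=1$. For a measurable function $g$ on $\mathbb{R}^d$ let $g^*(t)=\inf\{\tau>0:\ |\{x:|g(x)|>\tau\}|\le t\}$, $t>0$, be its nonincreasing rearrangement, and let $L^{p',p}(\mathbb{R}^d)$ be the Lorentz space of (classes of a.e. equal) complex measurable functions $g$ with $$\|g\|_{p',p}=\Big(\int_0^\infty \big(t^{1/p'}g^*(t)\big)^p\,\frac{dt}{t}\Big)^{1/p}<\infty .$$ Then the Fourier transform, given by $\mathcal{F}f(x)=\int_{\mathbb{R}^d} f(t)e^{-i\langle x,t\rangle}\,dt$ for $f\in L^1(\mathbb{R}^d)\cap L^p(\mathbb{R}^d)$, extends to a bounded linear operator $$\mathcal{F}:L^p(\mathbb{R}^d)\to L^{p',p}(\mathbb{R}^d),$$ and this operator is not strictly singular. That is, it is not the case that for every infinite-dimensional closed subspace $E\subset L^p(\mathbb{R}^d)$ and every $\varepsilon>0$ there is $f\in E$ with $\|f\|_p=1$ and $\|\mathcal{F}f\|_{p',p}\le\varepsilon$. This holds both for the complex space $L^p(\mathbb{R}^d)$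 of complex-valued functions (with complex subspaces $E$) and for the real space $L^p(\mathbb{R}^d)$ of real-valued functions (with real subspaces $E$). -/

import Mathlib

open MeasureTheory Set
open scoped ENNReal

noncomputable section

section Rearrangement

variable {α : Type*} [MeasurableSpace α]

/-- The distribution function `f_*(τ) = μ {x : |f x| > τ}`. -/
def distribution (μ : Measure α) (f : α → ℂ) (τ : ℝ≥0∞) : ℝ≥0∞ :=
  μ {x | τ < ‖f x‖ₑ}

/-- The nonincreasing rearrangement `f^*(t) = inf {τ > 0 : f_*(τ) ≤ t}`. The value `τ = ∞` is
always admissible, which realizes the convention `inf ∅ = ∞`. -/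
def rearrangement (μ : Measure α) (f : α → ℂ) (t : ℝ) : ℝ≥0∞ :=
  sInf {τ : ℝ≥0∞ | 0 < τ ∧ distribution μ f τ ≤ ENNReal.ofReal t}

/-- The Lorentz functional
`‖f‖_{r,s} = (∫_0^∞ (t^{1/r} f^*(t))^s dt/t)^{1/s} ∈ [0,∞]`, for `0 < r, s < ∞`. -/
def lorentzENorm (μ : Measure α) (r s : ℝ) (f : α → ℂ) : ℝ≥0∞ :=
  (∫⁻ t in Ioi (0 : ℝ),
    (ENNReal.ofReal (t ^ (1 / r)) * rearrangement μ f t) ^ s / ENNReal.ofReal t) ^ (1 / s)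

lemma rearrangement_antitone (μ : Measure α) (f : α → ℂ) : Antitone (rearrangement μ f) := by
  intro a b hab
  exact sInf_le_sInf fun τ hτ => ⟨hτ.1, hτ.2.trans (ENNReal.ofReal_le_ofReal hab)⟩

lemma rearrangement_congr {μ : Measure α} {f g : α → ℂ} (h : f =ᵐ[μ] g) :
    rearrangement μ f = rearrangement μ g := by
  have hd : distribution μ f = distribution μ g := by
    funext τ
    refine measure_congr ?_
    filter_upwards [h] with x hx
    change (τ < ‖f x‖ₑ) = (τ < ‖g x‖ₑ)
    rw [hx]
  funext t
  simp only [rearrangement, hd]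

lemma lorentzENorm_congr {μ : Measure α} {f g : α → ℂ} (r s : ℝ) (h : f =ᵐ[μ] g) :
    lorentzENorm μ r s f = lorentzENorm μ r s g := by
  simp only [lorentzENorm, rearrangement_congr h]

lemma rearrangement_add_le (μ : Measure α) (f g : α → ℂ) {t : ℝ} (ht : 0 ≤ t) :
    rearrangement μ (f + g) t ≤ rearrangement μ f (t / 2) + rearrangement μ g (t / 2) := by
  unfold rearrangement
  rw [sInf_eq_iInf (s := {τ : ℝ≥0∞ | 0 < τ ∧ distribution μ f τ ≤ ENNReal.ofReal (t / 2)}),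
    sInf_eq_iInf (s := {τ : ℝ≥0∞ | 0 < τ ∧ distribution μ g τ ≤ ENNReal.ofReal (t / 2)})]
  refine ENNReal.le_iInf₂_add_iInf₂ fun σ hσ τ hτ => sInf_le ⟨by simp [hσ.1], ?_⟩
  calc distribution μ (f + g) (σ + τ)
      ≤ μ ({x | σ < ‖f x‖ₑ} ∪ {x | τ < ‖g x‖ₑ}) := by
        refine measure_mono fun x hx => ?_
        by_contra hc
        simp only [mem_union, mem_ofPred_eq, not_or, not_lt] at hc hx
        exact absurd hx (not_lt.mpr ((enorm_add_le _ _).trans (add_le_add hc.1 hc.2)))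
    _ ≤ ENNReal.ofReal (t / 2) + ENNReal.ofReal (t / 2) :=
        (measure_union_le _ _).trans (add_le_add hσ.2 hτ.2)
    _ = ENNReal.ofReal t := by
        rw [← ENNReal.ofReal_add (by positivity) (by positivity), add_halves]

lemma rearrangement_smul_le (μ : Measure α) (c : ℂ) (f : α → ℂ) (t : ℝ) :
    rearrangement μ (c • f) t ≤ ‖c‖ₑ * rearrangement μ f t := by
  rcases eq_or_ne c 0 with rfl | hc
  · refine le_of_forall_gt fun τ hτ => ?_
    obtain ⟨ρ, hρ, hρτ⟩ := exists_between hτ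
    refine lt_of_le_of_lt (sInf_le ⟨by simpa using hρ, ?_⟩) hρτ
    simp [distribution]
  · have hc0 : ‖c‖ₑ ≠ 0 := by simpa using hc
    unfold rearrangement
    rw [sInf_eq_iInf (s := {τ : ℝ≥0∞ | 0 < τ ∧ distribution μ f τ ≤ ENNReal.ofReal t})]
    simp only [ENNReal.mul_iInf_of_ne hc0 enorm_ne_top]
    refine le_iInf₂ fun τ hτ => sInf_le ⟨ENNReal.mul_pos hc0 hτ.1.ne', ?_⟩
    refine le_trans (le_of_eq ?_) hτ.2
    unfold distribution
    congr 1
    ext x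
    simp only [mem_ofPred_eq, Pi.smul_apply, enorm_smul]
    exact ENNReal.mul_lt_mul_iff_right hc0 enorm_ne_top

lemma lorentzENorm_lt_top_iff {μ : Measure α} {r s : ℝ} (hs : 0 < s) {f : α → ℂ} :
    lorentzENorm μ r s f < ∞ ↔
      ∫⁻ t in Ioi (0 : ℝ), (ENNReal.ofReal (t ^ (1 / r)) * rearrangement μ f t) ^ s /
        ENNReal.ofReal t < ∞ := by
  have h : 0 < 1 / s := by positivity
  exact ENNReal.rpow_lt_top_iff_of_pos h

lemma measurable_lorentz_integrand (μ : Measure α) (r s : ℝ) (f : α → ℂ) :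
    Measurable fun t : ℝ =>
      (ENNReal.ofReal (t ^ (1 / r)) * rearrangement μ f t) ^ s / ENNReal.ofReal t := by
  have := (rearrangement_antitone μ f).measurable
  fun_prop

lemma lorentzENorm_smul_lt_top {μ : Measure α} {r s : ℝ} (hs : 0 < s) (c : ℂ) {f : α → ℂ}
    (hf : lorentzENorm μ r s f < ∞) : lorentzENorm μ r s (c • f) < ∞ := by
  rw [lorentzENorm_lt_top_iff hs] at hf ⊢
  refine lt_of_le_of_lt ?_ (ENNReal.mul_lt_top
    (ENNReal.rpow_lt_top_of_nonneg hs.le (enorm_ne_top (x := c))) hf)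
  rw [← lintegral_const_mul _ (measurable_lorentz_integrand μ r s f)]
  refine lintegral_mono fun t => ?_
  rw [← mul_div_assoc, ← ENNReal.mul_rpow_of_nonneg _ _ hs.le]
  refine ENNReal.div_le_div_right (ENNReal.rpow_le_rpow ?_ hs.le) _
  rw [mul_left_comm]
  exact mul_le_mul_right (rearrangement_smul_le μ c f t) _

lemma lintegral_lorentz_half_lt_top {μ : Measure α} {r s : ℝ} (hs : 0 < s) {f : α → ℂ}
    (hf : lorentzENorm μ r s f < ∞) :
    ∫⁻ t in Ioi (0 : ℝ), (ENNReal.ofReal (t ^ (1 / r)) * rearrangement μ f (t / 2)) ^ s /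
        ENNReal.ofReal t < ∞ := by
  rw [lorentzENorm_lt_top_iff hs] at hf
  set F : ℝ → ℝ≥0∞ := fun t =>
    (ENNReal.ofReal (t ^ (1 / r)) * rearrangement μ f t) ^ s / ENNReal.ofReal t with hF
  have hFm : Measurable F := measurable_lorentz_integrand μ r s f
  have hscale : ∫⁻ t in Ioi (0 : ℝ), F (2⁻¹ * t) < ∞ := by
    have h1 : ∫⁻ t in Ioi (0 : ℝ), F (2⁻¹ * t)
        = ∫⁻ t, (Ioi (0 : ℝ)).indicator F (2⁻¹ * t) := by
      rw [← lintegral_indicator measurableSet_Ioi]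
      refine lintegral_congr fun t => ?_
      by_cases ht : 0 < t
      · rw [indicator_of_mem (by exact ht), indicator_of_mem (by simpa using ht)]
      · rw [indicator_of_notMem (by exact ht), indicator_of_notMem (by simpa using ht)]
    rw [h1, ← lintegral_map (hFm.indicator measurableSet_Ioi) (by fun_prop),
      Real.map_volume_mul_left (by norm_num), lintegral_smul_measure,
      lintegral_indicator measurableSet_Ioi]
    exact ENNReal.mul_lt_top ENNReal.ofReal_lt_top hf
  set c : ℝ≥0∞ := ENNReal.ofReal ((2 : ℝ) ^ (1 / r)) ^ s with hc
  have hct : c < ∞ := ENNReal.rpow_lt_top_of_nonneg hs.le ENNReal.ofReal_ne_top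
  refine lt_of_le_of_lt ?_ (ENNReal.mul_lt_top hct hscale)
  rw [← lintegral_const_mul _ (by fun_prop)]
  refine setLIntegral_mono (by fun_prop) fun t ht => ?_
  have ht : 0 < t := ht
  have e1 : (2⁻¹ * t : ℝ) = t / 2 := by ring
  have e2 : t ^ (1 / r) = 2 ^ (1 / r) * (t / 2) ^ (1 / r) := by
    rw [← Real.mul_rpow (by norm_num) (by positivity)]
    congr 1; ring
  simp only [hF, e1, hc]
  rw [← mul_div_assoc, ← ENNReal.mul_rpow_of_nonneg _ _ hs.le, ← mul_assoc,
    ← ENNReal.ofReal_mul (by positivity), ← e2]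
  gcongr
  linarith

lemma lorentzENorm_add_lt_top {μ : Measure α} {r s : ℝ} (hs : 0 < s) {f g : α → ℂ}
    (hf : lorentzENorm μ r s f < ∞) (hg : lorentzENorm μ r s g < ∞) :
    lorentzENorm μ r s (f + g) < ∞ := by
  have hf' := lintegral_lorentz_half_lt_top hs hf
  have hg' := lintegral_lorentz_half_lt_top hs hg
  rw [lorentzENorm_lt_top_iff hs]
  have hmeas : ∀ h : α → ℂ, Measurable fun t : ℝ =>
      (ENNReal.ofReal (t ^ (1 / r)) * rearrangement μ h (t / 2)) ^ s / ENNReal.ofReal t := by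
    intro h
    have := (rearrangement_antitone μ h).measurable
    fun_prop
  have h2 : (2 : ℝ≥0∞) ^ s < ∞ := ENNReal.rpow_lt_top_of_nonneg hs.le (by simp)
  refine lt_of_le_of_lt ?_ (ENNReal.mul_lt_top h2 (ENNReal.add_lt_top.mpr ⟨hf', hg'⟩))
  rw [← lintegral_add_left (hmeas f),
    ← lintegral_const_mul (2 ^ s) (by exact (hmeas f).add (hmeas g))]
  refine setLIntegral_mono (((hmeas f).add (hmeas g)).const_mul _) fun t ht => ?_
  rw [← ENNReal.add_div, ← mul_div_assoc]
  gcongr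
  set A := ENNReal.ofReal (t ^ (1 / r)) * rearrangement μ f (t / 2)
  set B := ENNReal.ofReal (t ^ (1 / r)) * rearrangement μ g (t / 2)
  have hAB : ENNReal.ofReal (t ^ (1 / r)) * rearrangement μ (f + g) t ≤ 2 * max A B := by
    calc _ ≤ ENNReal.ofReal (t ^ (1 / r)) *
          (rearrangement μ f (t / 2) + rearrangement μ g (t / 2)) := by
          gcongr; exact rearrangement_add_le μ f g (le_of_lt ht)
      _ = A + B := mul_add _ _ _
      _ ≤ max A B + max A B := add_le_add (le_max_left _ _) (le_max_right _ _)
      _ = 2 * max A B := (two_mul _).symm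
  calc _ ≤ (2 * max A B) ^ s := ENNReal.rpow_le_rpow hAB hs.le
    _ = 2 ^ s * (max A B) ^ s := ENNReal.mul_rpow_of_nonneg _ _ hs.le
    _ ≤ 2 ^ s * (A ^ s + B ^ s) := by
        gcongr
        rcases le_total A B with h | h
        · rw [max_eq_right h]; exact le_add_self
        · rw [max_eq_left h]; exact le_self_add

end Rearrangement

/-- The Lorentz space `L^{r,s}(μ)`, `r, s ∈ (0,∞)`: classes of a.e. equal complex measurable
functions with `‖f‖_{r,s} < ∞`. -/
def lorentzSpace {α : Type*} [MeasurableSpace α] (μ : Measure α) {r s : ℝ}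
    (_hr : 0 < r) (hs : 0 < s) : Submodule ℂ (α →ₘ[μ] ℂ) where
  carrier := {f | lorentzENorm μ r s f < ∞}
  zero_mem' := by
    have h : lorentzENorm μ r s ((0 : ℂ) • (0 : α → ℂ)) < ∞ := by
      rw [lorentzENorm_lt_top_iff hs]
      have h0 : ∀ t, rearrangement μ ((0 : ℂ) • (0 : α → ℂ)) t = 0 := fun t =>
        le_antisymm ((rearrangement_smul_le μ 0 0 t).trans (by simp)) zero_le
      simp only [h0, mul_zero, ENNReal.zero_rpow_of_pos hs, ENNReal.zero_div, lintegral_zero,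
        ENNReal.zero_lt_top]
    rw [zero_smul] at h
    exact (lorentzENorm_congr r s (AEEqFun.coeFn_zero (μ := μ) (β := ℂ))).trans_lt h
  add_mem' {f g} hf hg :=
    (lorentzENorm_congr r s (AEEqFun.coeFn_add f g)).trans_lt (lorentzENorm_add_lt_top hs hf hg)
  smul_mem' c f hf :=
    (lorentzENorm_congr r s (AEEqFun.coeFn_smul c f)).trans_lt (lorentzENorm_smul_lt_top hs c hf)

/-- `‖f‖_{r,s}` on the Lorentz space, as a real number (finite by membership). -/
instance {α : Type*} [MeasurableSpace α] (μ : Measure α) {r s : ℝ} (hr : 0 < r) (hs : 0 < s) :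
    Norm (lorentzSpace μ hr hs) where
  norm f := (lorentzENorm μ r s (f : α →ₘ[μ] ℂ)).toReal

/-- A linear map `T` from a normed space `X` to a space `Y` with a (quasi-)norm is bounded. -/
def IsBoundedOperator {𝕜 X Y : Type*} [NontriviallyNormedField 𝕜] [NormedAddCommGroup X]
    [NormedSpace 𝕜 X] [AddCommMonoid Y] [Module 𝕜 Y] [Norm Y] (T : X →ₗ[𝕜] Y) : Prop :=
  ∃ C : ℝ, ∀ x : X, ‖T x‖ ≤ C * ‖x‖

/-- `T` is strictly singular: for every infinite-dimensional closed subspace `V` of `X` and every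
`ε > 0` there is `x` in the unit sphere of `V` with `‖T x‖ ≤ ε`. -/
def IsStrictlySingular {𝕜 X Y : Type*} [NontriviallyNormedField 𝕜] [NormedAddCommGroup X]
    [NormedSpace 𝕜 X] [AddCommMonoid Y] [Module 𝕜 Y] [Norm Y] (T : X →ₗ[𝕜] Y) : Prop :=
  ∀ V : Submodule 𝕜 X, IsClosed (V : Set X) → ¬ FiniteDimensional 𝕜 V →
    ∀ ε : ℝ, 0 < ε → ∃ x ∈ V, ‖x‖ = 1 ∧ ‖T x‖ ≤ ε

/-- The Fourier integral `∫ f(t) e^{-i⟨x,t⟩} dt` of a function on `ℝ^d`. -/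
def fourierIntegralFun {d : ℕ} (f : EuclideanSpace ℝ (Fin d) → ℂ)
    (x : EuclideanSpace ℝ (Fin d)) : ℂ :=
  ∫ t, f t * Complex.exp (-(Complex.I * ((inner ℝ x t : ℝ) : ℂ)))

/-- `T` is the Fourier transform `L^p(ℝ^d) → L^{r,s}(ℝ^d)`: the bounded linear operator which is
given by the Fourier integral on `L^1 ∩ L^p`. As `L^1 ∩ L^p` is dense in `L^p` for `p < ∞`, there is
at most one such `T`. -/
structure IsFourierTransform {d : ℕ} {p : ℝ≥0∞} [Fact (1 ≤ p)] {r s : ℝ} {hr : 0 < r} {hs : 0 < s}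
    (T : Lp ℂ p (volume : Measure (EuclideanSpace ℝ (Fin d))) →ₗ[ℂ]
      lorentzSpace (volume : Measure (EuclideanSpace ℝ (Fin d))) hr hs) : Prop where
  bounded : IsBoundedOperator T
  eq_integral : ∀ f : Lp ℂ p (volume : Measure (EuclideanSpace ℝ (Fin d))),
    Integrable f volume →
      ((T f : EuclideanSpace ℝ (Fin d) →ₘ[volume] ℂ) : EuclideanSpace ℝ (Fin d) → ℂ)
        =ᵐ[volume] fourierIntegralFun f

/-- The inclusion of the real-valued functions in `L^p(ℝ^d)` into the complex-valued ones. -/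
def realToComplexLp (d : ℕ) (p : ℝ≥0∞) [Fact (1 ≤ p)] :
    Lp ℝ p (volume : Measure (EuclideanSpace ℝ (Fin d))) →ₗ[ℝ]
      Lp ℂ p (volume : Measure (EuclideanSpace ℝ (Fin d))) :=
  (Complex.ofRealCLM.compLpL p volume).toLinearMap

end

/-! The second Lorentz index equals the exponent `p` of the source, so both `L^p` and `L^{p',p}`
contain an `ℓ^p` structure made of pieces at lacunary scales, and the Fourier transform carries one
to the other.

Boundedness is Paley's refinement of Hausdorff–Young, by real interpolation. The transform is
defined on `L¹ + L²`. Cutting `f` at height `f^*(2^m)` and using `L¹ → L^∞` above and `L² → L²`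
below bounds `g^*(2^{-m})` by a sum over dyadic values of `f^*`. After normalization this is a
convolution on `ℤ` with the kernel `2^{-θ|j|}`, so Young's inequality gives the `ℓ^p` bound
(`exists_lorentzENorm_le_of_rearrangement_le`).

For the failure of strict singularity, take a real, rapidly decaying `ρ` whose Fourier transform is
`1` on one annulus and vanishes outside a larger one, and dilate it by powers of `8`, normalized in
`L^p`. Each dilate is concentrated near its own scale, so a combination with coefficients `a` has
`L^p` norm at most a constant times `‖a‖_{ℓ^p}` (`exists_lintegral_sum_lpDilate_le`). On the
frequency side there are disjoint annuli, of volume comparable to `8^{-dk}`, on which the transform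
of the combination has modulus exactly `|a_k| 8^{dk/p'}`. These values show up in `g^*` at distinct
dyadic places, whence `‖a‖_{ℓ^p}` is at most a constant times the `L^{p',p}` functional
(`exists_tsum_le_lorentzENorm_fourier_sum`). So the transform is bounded below on the span of the
dilates, and then on its closure. Since the dilates are real-valued, the same family settles the
real case. -/

/-! ### Sums over `ℤ` and dyadic decompositions. -/

/-- Jensen's inequality for weighted sums in `[0, ∞]`. -/
lemma ENNReal.tsum_mul_rpow_le {ι : Type*} {p : ℝ} (hp : 1 < p) (w b : ι → ℝ≥0∞) :
    (∑' i, w i * b i) ^ p ≤ (∑' i, w i) ^ (p - 1) * ∑' i, w i * b i ^ p := by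
  have hpq := Real.HolderConjugate.conjExponent hp
  set q := Real.conjExponent p
  have hp0 : 0 < p := by linarith
  have hq0 : 0 < q := hpq.symm.pos
  let _ : MeasurableSpace ι := ⊤
  -- Hölder for counting measure, with the weight split as `w = w^{1/p} · w^{1/q}`.
  have h := ENNReal.lintegral_mul_le_Lp_mul_Lq (Measure.count : Measure ι) hpq
    (f := fun i => w i ^ (1 / p) * b i) (g := fun i => w i ^ (1 / q))
    (measurable_from_top).aemeasurable (measurable_from_top).aemeasurable
  simp only [lintegral_count, Pi.mul_apply] at h
  have e1 : ∀ i, w i ^ (1 / p) * b i * w i ^ (1 / q) = w i * b i := fun i => by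
    rw [mul_right_comm, ← ENNReal.rpow_add_of_nonneg _ _ (by positivity) (by positivity)]
    have := hpq.inv_add_inv_eq_one
    rw [one_div, one_div, this, ENNReal.rpow_one]
  have e2 : ∀ i, (w i ^ (1 / p) * b i) ^ p = w i * b i ^ p := fun i => by
    rw [ENNReal.mul_rpow_of_nonneg _ _ hp0.le, ← ENNReal.rpow_mul, one_div_mul_cancel hp0.ne',
      ENNReal.rpow_one]
  have e3 : ∀ i, (w i ^ (1 / q)) ^ q = w i := fun i => by
    rw [← ENNReal.rpow_mul, one_div_mul_cancel hq0.ne', ENNReal.rpow_one]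
  simp only [e1, e2, e3] at h
  calc _ ≤ _ := ENNReal.rpow_le_rpow h hp0.le
    _ = _ := by
      rw [ENNReal.mul_rpow_of_nonneg _ _ hp0.le, ← ENNReal.rpow_mul, ← ENNReal.rpow_mul,
        one_div_mul_cancel hp0.ne', ENNReal.rpow_one, mul_comm]
      congr 2
      rw [one_div, inv_mul_eq_div]; exact hpq.div_conj_eq_sub_one

/-- Young's inequality for convolutions on `ℤ`. -/
lemma ENNReal.tsum_conv_rpow_le {p : ℝ} (hp : 1 < p) (K b : ℤ → ℝ≥0∞) :
    ∑' m, (∑' k, K (m - k) * b k) ^ p ≤ (∑' j, K j) ^ p * ∑' k, b k ^ p := by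
  have hK : ∀ m : ℤ, ∑' k, K (m - k) = ∑' j, K j := fun m => (Equiv.subLeft m).tsum_eq K
  have hK' : ∀ k : ℤ, ∑' m, K (m - k) = ∑' j, K j := fun k => (Equiv.subRight k).tsum_eq K
  calc _ ≤ ∑' m, (∑' j, K j) ^ (p - 1) * ∑' k, K (m - k) * b k ^ p := by
        refine ENNReal.tsum_le_tsum fun m => ?_
        rw [← hK m]
        exact ENNReal.tsum_mul_rpow_le hp _ _
    _ = (∑' j, K j) ^ (p - 1) * (∑' j, K j) * ∑' k, b k ^ p := by
        rw [ENNReal.tsum_mul_left, ENNReal.tsum_comm]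
        simp only [ENNReal.tsum_mul_right, hK']
        rw [ENNReal.tsum_mul_left, mul_assoc]
    _ = _ := by
        congr 1
        have := ENNReal.rpow_add_of_nonneg (x := ∑' j, K j) (p - 1) 1 (by linarith) (by norm_num)
        rw [sub_add_cancel, ENNReal.rpow_one] at this
        exact this.symm

/-- `√(∑ aᵢ²) ≤ ∑ aᵢ`. -/
lemma ENNReal.tsum_sq_le {ι : Type*} (a : ι → ℝ≥0∞) : ∑' i, a i ^ 2 ≤ (∑' i, a i) ^ 2 := by
  rw [sq, ← ENNReal.tsum_mul_right]
  exact ENNReal.tsum_le_tsum fun i => by rw [sq]; gcongr; exact ENNReal.le_tsum i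

/-- Summability of the kernel that enters Young's inequality, both in the interpolation and in the
upper estimate for dilates. -/
lemma ENNReal.tsum_two_rpow_neg_abs_ne_top {θ : ℝ} (hθ : 0 < θ) :
    ∑' j : ℤ, (2 : ℝ≥0∞) ^ (-(θ * |(j : ℝ)|)) ≠ ∞ := by
  have h1 : (2 : ℝ) ^ (-θ) < 1 := Real.rpow_lt_one_of_one_lt_of_neg (by norm_num) (by linarith)
  have hs : Summable fun n : ℕ => (2 : ℝ) ^ (-(θ * (n : ℝ))) := by
    refine (summable_geometric_of_lt_one (by positivity) h1).congr fun n => ?_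
    rw [← Real.rpow_natCast, ← Real.rpow_mul (by norm_num)]
    ring_nf
  have hsum : Summable fun j : ℤ => (2 : ℝ) ^ (-(θ * |(j : ℝ)|)) := by
    refine Summable.of_nat_of_neg ?_ ?_ <;> simpa using hs
  convert hsum.tsum_ofReal_ne_top using 3 with j
  rw [← ENNReal.ofReal_rpow_of_pos (by norm_num)]
  simp

lemma ENNReal.two_rpow_add (x y : ℝ) : (2 : ℝ≥0∞) ^ (x + y) = 2 ^ x * 2 ^ y :=
  ENNReal.rpow_add _ _ (by norm_num) (by norm_num)

lemma ENNReal.ofReal_two_zpow (k : ℤ) : ENNReal.ofReal ((2 : ℝ) ^ k) = 2 ^ (k : ℝ) := by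
  rw [← Real.rpow_intCast, ← ENNReal.ofReal_rpow_of_pos (by norm_num)]
  simp

/-- A decreasing sequence indexed by `ℤ` crosses each level between its bounds. -/
lemma Antitone.exists_lt_le_of_int {β : Type*} [LinearOrder β] {c : ℤ → β} (hc : Antitone c)
    {y : β} (h1 : ∃ k, y ≤ c k) (h2 : ∃ k, c k < y) : ∃ k, c (k + 1) < y ∧ y ≤ c k := by
  obtain ⟨b, hb⟩ := h2
  obtain ⟨k, hk, hmax⟩ := Int.exists_greatest_of_bdd (P := fun z => y ≤ c z)
    ⟨b, fun z hz => le_of_not_gt fun h => absurd (hz.trans (hc h.le)) (not_le.2 hb)⟩ h1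
  exact ⟨k, lt_of_not_ge fun h => by have := hmax _ h; omega, hk⟩

lemma lintegral_Ioi_eq_tsum_dyadic (F : ℝ → ℝ≥0∞) :
    ∫⁻ t in Ioi (0 : ℝ), F t = ∑' k : ℤ, ∫⁻ t in Ioc ((2 : ℝ) ^ k) (2 ^ (k + 1)), F t := by
  rw [← lintegral_iUnion (fun _ => measurableSet_Ioc)]
  · congr 2
    ext t
    simp only [mem_Ioi, mem_iUnion]
    exact ⟨fun ht => exists_mem_Ioc_zpow ht (by norm_num),
      fun ⟨k, hk⟩ => lt_trans (by positivity) hk.1⟩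
  · intro i j hij
    refine Set.disjoint_left.2 fun t hi hj => hij ?_
    have h1 := (zpow_lt_zpow_iff_right₀ (by norm_num : (1 : ℝ) < 2)).1 (hi.1.trans_le hj.2)
    have h2 := (zpow_lt_zpow_iff_right₀ (by norm_num : (1 : ℝ) < 2)).1 (hj.1.trans_le hi.2)
    omega

lemma volume_Ioc_dyadic (k : ℤ) :
    volume (Ioc ((2 : ℝ) ^ k) (2 ^ (k + 1))) = 2 ^ (k : ℝ) := by
  rw [Real.volume_Ioc, ← ENNReal.ofReal_two_zpow, zpow_add_one₀ (by norm_num)]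
  congr 1; ring

/-! ### Rearrangements, `L^p` integrals and dyadic sums. -/

section RearrangementBounds

variable {α : Type*} [MeasurableSpace α] {μ : Measure α} {f : α → ℂ}

lemma distribution_antitone (μ : Measure α) (f : α → ℂ) : Antitone (distribution μ f) :=
  fun _ _ h => measure_mono fun _ hx => lt_of_le_of_lt h hx

/-- Only positive levels are admissible in the infimum; passing through all `σ > τ` includes the
case `τ = 0`. -/
lemma rearrangement_le_of_distribution_le {τ : ℝ≥0∞} {t : ℝ}
    (h : distribution μ f τ ≤ ENNReal.ofReal t) : rearrangement μ f t ≤ τ :=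
  le_of_forall_gt_imp_ge_of_dense fun _ hσ =>
    sInf_le ⟨zero_le.trans_lt hσ, (distribution_antitone μ f hσ.le).trans h⟩

lemma lt_distribution_of_lt_rearrangement {τ : ℝ≥0∞} {t : ℝ}
    (h : τ < rearrangement μ f t) : ENNReal.ofReal t < distribution μ f τ :=
  lt_of_not_ge fun hc => absurd (rearrangement_le_of_distribution_le hc) (not_le.2 h)

/-- The infimum in the definition of the rearrangement is attained. -/
lemma distribution_rearrangement_le (μ : Measure α) (f : α → ℂ) (t : ℝ) :
    distribution μ f (rearrangement μ f t) ≤ ENNReal.ofReal t := by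
  obtain ⟨u, hu, hlim, hmem⟩ := exists_seq_tendsto_sInf
    (S := {τ : ℝ≥0∞ | 0 < τ ∧ distribution μ f τ ≤ ENNReal.ofReal t})
    ⟨∞, by simp, by simp [distribution]⟩ (OrderBot.bddBelow _)
  have hset : {x | rearrangement μ f t < ‖f x‖ₑ} = ⋃ n, {x | u n < ‖f x‖ₑ} := by
    ext x
    simp only [mem_ofPred_eq, mem_iUnion]
    exact ⟨fun h => (hlim.eventually_lt_const h).exists,
      fun ⟨n, hn⟩ => (sInf_le (hmem n)).trans_lt hn⟩
  have hmono : Monotone fun n => {x | u n < ‖f x‖ₑ} :=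
    fun m n hmn x hx => (hu hmn).trans_lt hx
  rw [distribution, hset, hmono.measure_iUnion]
  exact iSup_le fun n => (hmem n).2

/-- Were `f^*(t) < b`, the set where `|f|` exceeds `f^*(t)` would contain `s`, yet its measure is at
most `t` because the infimum is attained. This is the source of all lower bounds for rearrangements.
-/
lemma le_rearrangement_of_lt_measure {s : Set α} {b : ℝ≥0∞} {t : ℝ}
    (hs : ∀ x ∈ s, b ≤ ‖f x‖ₑ) (ht : ENNReal.ofReal t < μ s) : b ≤ rearrangement μ f t := by
  refine le_of_forall_lt fun τ hτ => ?_
  by_contra h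
  refine absurd ((measure_mono fun x hx => ?_).trans (distribution_rearrangement_le μ f t))
    (not_le.2 ht)
  exact ((not_lt.1 h).trans_lt hτ).trans_le (hs x hx)

/-- Chebyshev's inequality for the rearrangement. -/
lemma rearrangement_le_lintegral_div_rpow (hf : AEMeasurable f μ) {p : ℝ} (hp : 0 < p) {t : ℝ}
    (ht : 0 < t) :
    rearrangement μ f t ≤ ((∫⁻ x, ‖f x‖ₑ ^ p ∂μ) / ENNReal.ofReal t) ^ (1 / p) := by
  set I := ∫⁻ x, ‖f x‖ₑ ^ p ∂μ
  have ht' : ENNReal.ofReal t ≠ 0 := by simpa using ht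
  refine le_of_forall_gt_imp_ge_of_dense fun τ hτ => rearrangement_le_of_distribution_le ?_
  rcases eq_or_ne τ ∞ with rfl | hτ'
  · simp [distribution]
  have hτp : I / ENNReal.ofReal t < τ ^ p := by
    have := ENNReal.rpow_lt_rpow hτ hp
    rwa [← ENNReal.rpow_mul, one_div_mul_cancel hp.ne', ENNReal.rpow_one] at this
  have hτp0 : τ ^ p ≠ 0 := (zero_le.trans_lt hτp).ne'
  have hτpt : τ ^ p ≠ ∞ := ENNReal.rpow_ne_top_of_nonneg hp.le hτ'
  calc distribution μ f τ ≤ μ {x | τ ^ p ≤ ‖f x‖ₑ ^ p} :=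
        measure_mono fun x hx => ENNReal.rpow_le_rpow (le_of_lt hx) hp.le
    _ ≤ I / τ ^ p := meas_ge_le_lintegral_div (by fun_prop) hτp0 hτpt
    _ ≤ ENNReal.ofReal t := by
        rw [ENNReal.div_lt_iff (Or.inl ht') (Or.inl ENNReal.ofReal_ne_top)] at hτp
        rw [ENNReal.div_le_iff_le_mul (Or.inl hτp0) (Or.inl hτpt), mul_comm]
        exact hτp.le

/-- Layer-cake formula on both sides: the set of `t > 0` with `f^*(t) > τ` lies in an interval
starting at `0` of length the distribution function at `τ`. -/
lemma lintegral_rearrangement_rpow_le (hf : Measurable f) {p : ℝ} (hp : 0 < p) :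
    ∫⁻ t in Ioi (0 : ℝ), rearrangement μ f t ^ p ≤ ∫⁻ x, ‖f x‖ₑ ^ p ∂μ := by
  rcases eq_or_ne (∫⁻ x, ‖f x‖ₑ ^ p ∂μ) ∞ with hI | hI
  · simp [hI]
  have hfin : ∀ t : ℝ, 0 < t → rearrangement μ f t ≠ ∞ := fun t ht =>
    ne_top_of_le_ne_top (ENNReal.rpow_ne_top_of_nonneg (by positivity)
      (ENNReal.div_ne_top hI (by simpa using ht)))
      (rearrangement_le_lintegral_div_rpow hf.aemeasurable hp ht)
  have hm : Measurable (rearrangement μ f) := (rearrangement_antitone μ f).measurable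
  have e1 : ∫⁻ t in Ioi (0 : ℝ), rearrangement μ f t ^ p
      = ∫⁻ t in Ioi (0 : ℝ), ENNReal.ofReal ((rearrangement μ f t).toReal ^ p) := by
    refine setLIntegral_congr_fun measurableSet_Ioi fun t ht => ?_
    rw [← ENNReal.ofReal_rpow_of_nonneg ENNReal.toReal_nonneg hp.le,
      ENNReal.ofReal_toReal (hfin t ht)]
  have e2 : ∫⁻ x, ‖f x‖ₑ ^ p ∂μ = ∫⁻ x, ENNReal.ofReal (‖f x‖ ^ p) ∂μ := by
    refine lintegral_congr fun x => ?_
    rw [← ENNReal.ofReal_rpow_of_nonneg (norm_nonneg _) hp.le, ofReal_norm]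
  rw [e1, e2, lintegral_rpow_eq_lintegral_meas_lt_mul _ (by filter_upwards with t; simp)
      (by fun_prop) hp,
    lintegral_rpow_eq_lintegral_meas_lt_mul _ (by filter_upwards with t; simp)
      (by fun_prop) hp]
  gcongr ENNReal.ofReal p * ?_
  refine setLIntegral_mono' measurableSet_Ioi fun τ hτ => ?_
  gcongr
  have hτ0 : (0 : ℝ) < τ := hτ
  have hd : distribution μ f (ENNReal.ofReal τ) = μ {a | τ < ‖f a‖} := by
    unfold distribution
    congr 1; ext x
    simp only [mem_ofPred_eq]
    rw [← ofReal_norm, ENNReal.ofReal_lt_ofReal_iff_of_nonneg hτ0.le]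
  rw [← hd, Measure.restrict_apply (measurableSet_lt measurable_const (by fun_prop))]
  set D := distribution μ f (ENNReal.ofReal τ)
  rcases eq_or_ne D ∞ with hD | hD
  · simp [hD]
  calc _ ≤ volume (Ioo 0 D.toReal) := by
        refine measure_mono fun t ht => ⟨ht.2, ?_⟩
        have h2 : (0 : ℝ) < t := ht.2
        have := lt_distribution_of_lt_rearrangement
          ((ENNReal.ofReal_lt_iff_lt_toReal hτ0.le (hfin t h2)).2 ht.1)
        exact (ENNReal.ofReal_lt_iff_lt_toReal h2.le hD).1 this
    _ = D := by rw [Real.volume_Ioo, sub_zero, ENNReal.ofReal_toReal hD]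

/-- The dyadic form of `∫ (f^*)^p ≤ ∫ |f|^p`. -/
lemma tsum_dyadic_rearrangement_le (hf : Measurable f) {p : ℝ} (hp : 0 < p) :
    ∑' k : ℤ, (2 ^ (k / p : ℝ) * rearrangement μ f (2 ^ k)) ^ p ≤ 2 * ∫⁻ x, ‖f x‖ₑ ^ p ∂μ := by
  refine le_trans ?_ (mul_le_mul_right (lintegral_rearrangement_rpow_le (μ := μ) hf hp) 2)
  -- Each value is compared with the block to its left, where the rearrangement is larger. The block
  -- ending at `2^{k+1}` has length `2^k`, hence the factor `2`.
  rw [lintegral_Ioi_eq_tsum_dyadic, ← ENNReal.tsum_mul_left, ← (Equiv.addRight (1 : ℤ)).tsum_eq]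
  refine ENNReal.tsum_le_tsum fun k => ?_
  calc _ = 2 * ∫⁻ _ in Ioc ((2 : ℝ) ^ k) (2 ^ (k + 1)), rearrangement μ f (2 ^ (k + 1)) ^ p := by
        rw [setLIntegral_const, volume_Ioc_dyadic, ENNReal.mul_rpow_of_nonneg _ _ hp.le,
          ← ENNReal.rpow_mul, div_mul_cancel₀ _ hp.ne']
        simp only [Equiv.coe_addRight, Int.cast_add, Int.cast_one, ENNReal.two_rpow_add,
          ENNReal.rpow_one]
        ring
    _ ≤ _ := by
        gcongr 2 * ?_
        refine setLIntegral_mono' measurableSet_Ioc fun t ht => ?_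
        exact ENNReal.rpow_le_rpow (rearrangement_antitone μ f ht.2) hp.le

/-- The Lorentz functional is controlled by the dyadic values of the rearrangement. -/
lemma lorentzENorm_rpow_le_tsum_dyadic {r s : ℝ} (hr : 0 < r) (hs : 0 < s) (f : α → ℂ) :
    lorentzENorm μ r s f ^ s ≤
      ∑' k : ℤ, (2 ^ ((k + 1) / r : ℝ) * rearrangement μ f (2 ^ k)) ^ s := by
  rw [lorentzENorm, ← ENNReal.rpow_mul, one_div_mul_cancel hs.ne', ENNReal.rpow_one,
    lintegral_Ioi_eq_tsum_dyadic]
  refine ENNReal.tsum_le_tsum fun k => ?_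
  calc _ ≤ ∫⁻ _ in Ioc ((2 : ℝ) ^ k) (2 ^ (k + 1)),
        (2 ^ ((k + 1) / r : ℝ) * rearrangement μ f (2 ^ k)) ^ s / 2 ^ (k : ℝ) := by
        refine setLIntegral_mono' measurableSet_Ioc fun t ht => ?_
        have ht0 : 0 < t := lt_trans (by positivity) ht.1
        rw [← ENNReal.ofReal_two_zpow k]
        gcongr
        · rw [← ENNReal.ofReal_rpow_of_pos ht0, div_eq_mul_one_div ((k : ℝ) + 1),
            ENNReal.rpow_mul]
          gcongr
          have := ENNReal.ofReal_two_zpow (k + 1)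
          push_cast at this
          rw [← this]
          exact ENNReal.ofReal_le_ofReal ht.2
        · exact rearrangement_antitone μ f ht.1.le
        · exact ht.1.le
    _ = _ := by
        rw [setLIntegral_const, volume_Ioc_dyadic, ENNReal.div_mul_cancel]
        · exact (ENNReal.rpow_pos (by norm_num) (by norm_num)).ne'
        · exact ENNReal.rpow_ne_top_of_ne_zero (by norm_num) (by norm_num)

end RearrangementBounds

/-! ### Real interpolation by dyadic layers. -/

section Interpolation

variable {α β : Type*} [MeasurableSpace α] [MeasurableSpace β] {μ : Measure α} {ν : Measure β}
  {f : α → ℂ}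

lemma antitone_dyadic_rearrangement (μ : Measure α) (f : α → ℂ) :
    Antitone fun k : ℤ => rearrangement μ f (2 ^ k) :=
  fun _ _ h => rearrangement_antitone μ f (zpow_le_zpow_right₀ (by norm_num) h)

lemma distribution_dyadic_rearrangement_le (μ : Measure α) (f : α → ℂ) (k : ℤ) :
    μ {x | rearrangement μ f (2 ^ k) < ‖f x‖ₑ} ≤ 2 ^ (k : ℝ) :=
  (distribution_rearrangement_le μ f _).trans_eq (ENNReal.ofReal_two_zpow k)

/-- The exceptional set lies in superlevel sets of measure at most `2^{-n}` for every `n`. -/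
lemma ae_exists_le_dyadic_rearrangement (μ : Measure α) (f : α → ℂ) :
    ∀ᵐ x ∂μ, ∃ k : ℤ, ‖f x‖ₑ ≤ rearrangement μ f (2 ^ k) := by
  rw [ae_iff]
  refine le_antisymm (le_of_forall_gt_imp_ge_of_dense fun ε hε => ?_) zero_le
  obtain ⟨n, hn⟩ := ENNReal.exists_inv_two_pow_lt hε.ne'
  refine le_trans ?_ hn.le
  calc _ ≤ μ {x | rearrangement μ f (2 ^ (-n : ℤ)) < ‖f x‖ₑ} := by
        refine measure_mono fun x hx => ?_
        simp only [mem_ofPred_eq, not_exists, not_le] at hx ⊢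
        exact hx _
    _ ≤ _ := (distribution_dyadic_rearrangement_le μ f _).trans_eq (by
        rw [Int.cast_neg, ENNReal.rpow_neg, Int.cast_natCast, ENNReal.rpow_natCast,
          ENNReal.inv_pow])

/-- Chebyshev's inequality forces `f^*(t) → 0` as `t → ∞`. -/
lemma exists_dyadic_rearrangement_lt (hf : AEMeasurable f μ) {p : ℝ} (hp : 0 < p)
    (hI : ∫⁻ x, ‖f x‖ₑ ^ p ∂μ ≠ ∞) {y : ℝ≥0∞} (hy : y ≠ 0) :
    ∃ k : ℤ, rearrangement μ f (2 ^ k) < y := by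
  have hlim : Filter.Tendsto (fun t : ℝ =>
      ((∫⁻ x, ‖f x‖ₑ ^ p ∂μ) / ENNReal.ofReal t) ^ (1 / p)) Filter.atTop (nhds 0) := by
    have h1 : Filter.Tendsto (fun t : ℝ => (∫⁻ x, ‖f x‖ₑ ^ p ∂μ) / ENNReal.ofReal t)
        Filter.atTop (nhds ((∫⁻ x, ‖f x‖ₑ ^ p ∂μ) / ∞)) :=
      ENNReal.Tendsto.const_div ENNReal.tendsto_ofReal_atTop (Or.inr hI)
    rw [ENNReal.div_top] at h1
    have := h1.ennrpow_const (1 / p)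
    rwa [ENNReal.zero_rpow_of_pos (by positivity)] at this
  have hpow : Filter.Tendsto (fun n : ℕ => (2 : ℝ) ^ n) Filter.atTop Filter.atTop :=
    tendsto_pow_atTop_atTop_of_one_lt (by norm_num)
  obtain ⟨n, hn⟩ := ((hlim.comp hpow).eventually_lt_const (pos_iff_ne_zero.2 hy)).exists
  refine ⟨n, lt_of_le_of_lt ?_ hn⟩
  rw [zpow_natCast]
  exact rearrangement_le_lintegral_div_rpow hf hp (by positivity)

/-- Split into layers `c (k+1) < |f| ≤ c k`: each has measure at most `2^{k+1}`, and those meeting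
`|f| > c m` have `k < m`. -/
lemma lintegral_enorm_gt_dyadic_le (hf : Measurable f) (m : ℤ) :
    ∫⁻ x in {x | rearrangement μ f (2 ^ m) < ‖f x‖ₑ}, ‖f x‖ₑ ∂μ ≤
      ∑' k : ℤ, if k < m then rearrangement μ f (2 ^ k) * 2 ^ (k + 1 : ℝ) else 0 := by
  set c := fun k : ℤ => rearrangement μ f (2 ^ k) with hc
  have hcm : ∀ k, MeasurableSet {x | c k < ‖f x‖ₑ} :=
    fun k => measurableSet_lt measurable_const (by fun_prop)
  rw [← lintegral_indicator (hcm m)]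
  calc _ ≤ ∫⁻ x, ∑' k : ℤ, (if k < m then {x | c (k + 1) < ‖f x‖ₑ}.indicator (fun _ => c k) x
          else 0) ∂μ := by
        refine lintegral_mono_ae ?_
        filter_upwards [ae_exists_le_dyadic_rearrangement μ f] with x hx
        by_cases hxm : c m < ‖f x‖ₑ
        · obtain ⟨k, hk1, hk2⟩ :=
            (antitone_dyadic_rearrangement μ f).exists_lt_le_of_int hx ⟨m, hxm⟩
          have hkm : k < m := lt_of_not_ge fun h =>
            absurd ((hk2.trans (antitone_dyadic_rearrangement μ f h)).trans_lt hxm) (lt_irrefl _)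
          rw [indicator_of_mem (by exact hxm)]
          refine le_trans ?_ (ENNReal.le_tsum k)
          rw [if_pos hkm, indicator_of_mem (by exact hk1)]
          exact hk2
        · rw [indicator_of_notMem (by exact hxm)]
          exact zero_le
    _ = ∑' k : ℤ, ∫⁻ x, (if k < m then {x | c (k + 1) < ‖f x‖ₑ}.indicator (fun _ => c k) x
          else 0) ∂μ := lintegral_tsum fun k => by
        split_ifs
        · exact (measurable_const.indicator (hcm _)).aemeasurable
        · fun_prop
    _ ≤ _ := by
        refine ENNReal.tsum_le_tsum fun k => ?_
        split_ifs
        · rw [lintegral_indicator (hcm _), setLIntegral_const]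
          gcongr
          exact_mod_cast distribution_dyadic_rearrangement_le μ f (k + 1)
        · simp

/-- The same layers, now with `k ≥ m`; they exhaust the nonzero values because `c k → 0`. Replacing
the sum of squares by the square of the sum makes the bound linear in `c k` once the root is taken.
-/
lemma lintegral_enorm_sq_le_dyadic_le (hf : Measurable f) {p : ℝ} (hp : 0 < p)
    (hI : ∫⁻ x, ‖f x‖ₑ ^ p ∂μ ≠ ∞) (m : ℤ) :
    ∫⁻ x in {x | ‖f x‖ₑ ≤ rearrangement μ f (2 ^ m)}, ‖f x‖ₑ ^ 2 ∂μ ≤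
      (∑' k : ℤ, if m ≤ k then rearrangement μ f (2 ^ k) * 2 ^ ((k + 1) / 2 : ℝ) else 0) ^ 2 := by
  refine le_trans ?_ (ENNReal.tsum_sq_le _)
  set c := fun k : ℤ => rearrangement μ f (2 ^ k) with hc
  have hcm : ∀ k, MeasurableSet {x | c k < ‖f x‖ₑ} :=
    fun k => measurableSet_lt measurable_const (by fun_prop)
  have hcm' : MeasurableSet {x | ‖f x‖ₑ ≤ c m} := measurableSet_le (by fun_prop) measurable_const
  rw [← lintegral_indicator hcm']
  calc _ ≤ ∫⁻ x, ∑' k : ℤ, (if m ≤ k then {x | c (k + 1) < ‖f x‖ₑ}.indicator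
          (fun _ => c k ^ 2) x else 0) ∂μ := by
        refine lintegral_mono fun x => ?_
        -- A zero of `f` lies in no layer, but contributes nothing to the integral.
        by_cases hx0 : ‖f x‖ₑ = 0
        · by_cases hxm : ‖f x‖ₑ ≤ c m <;> simp [indicator, hx0]
        by_cases hxm : ‖f x‖ₑ ≤ c m
        · obtain ⟨k, hk1, hk2⟩ := (antitone_dyadic_rearrangement μ f).exists_lt_le_of_int ⟨m, hxm⟩
            (exists_dyadic_rearrangement_lt hf.aemeasurable hp hI hx0)
          have hkm : m ≤ k := Int.le_of_lt_add_one <| lt_of_not_ge fun h =>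
            absurd ((hxm.trans (antitone_dyadic_rearrangement μ f h)).trans_lt hk1) (lt_irrefl _)
          rw [indicator_of_mem (by exact hxm)]
          refine le_trans ?_ (ENNReal.le_tsum k)
          rw [if_pos hkm, indicator_of_mem (by exact hk1)]
          gcongr
        · rw [indicator_of_notMem (by exact hxm)]
          exact zero_le
    _ = ∑' k : ℤ, ∫⁻ x, (if m ≤ k then {x | c (k + 1) < ‖f x‖ₑ}.indicator
          (fun _ => c k ^ 2) x else 0) ∂μ := lintegral_tsum fun k => by
        split_ifs
        · exact (measurable_const.indicator (hcm _)).aemeasurable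
        · fun_prop
    _ ≤ _ := by
        refine ENNReal.tsum_le_tsum fun k => ?_
        split_ifs
        · rw [lintegral_indicator (hcm _), setLIntegral_const, mul_pow,
            ← ENNReal.rpow_natCast (2 ^ _), ← ENNReal.rpow_mul]
          gcongr
          have := distribution_dyadic_rearrangement_le μ f (k + 1)
          simpa using this
        · simp

/-- Real interpolation between `L¹ → L^∞` and `L² → L²`, with the Lorentz space `L^{p',p}` as the
target. The two endpoint bounds enter through the inequality for the rearrangement of `g`. -/
lemma exists_lorentzENorm_le_of_rearrangement_le {p p' : ℝ} (hp1 : 1 < p) (hp2 : p < 2)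
    (hpp' : p.HolderConjugate p') {K : ℝ≥0∞} (hK : K ≠ ∞) :
    ∃ C : ℝ≥0∞, C ≠ ∞ ∧ ∀ (f : α → ℂ) (g : β → ℂ), Measurable f → ∫⁻ x, ‖f x‖ₑ ^ p ∂μ ≠ ∞ →
      (∀ (s : ℝ≥0∞) (t : ℝ), 0 < t → rearrangement ν g t ≤
        (∫⁻ x in {x | s < ‖f x‖ₑ}, ‖f x‖ₑ ∂μ) +
          K * ((∫⁻ x in {x | ‖f x‖ₑ ≤ s}, ‖f x‖ₑ ^ 2 ∂μ) / ENNReal.ofReal t) ^ (1 / 2 : ℝ)) →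
      lorentzENorm ν p' p g ≤ C * (∫⁻ x, ‖f x‖ₑ ^ p ∂μ) ^ (1 / p) := by
  have hp0 : 0 < p := hpp'.pos
  have hp'0 : 0 < p' := hpp'.symm.pos
  -- The distances from `1/p` to the endpoints `1` and `1/2`: they are the decay rates in `|m - k|`
  -- of the contributions with `k < m` and with `k ≥ m`.
  set θ := min (1 - 1 / p) (1 / p - 1 / 2) with hθdef
  have hθ1 : θ ≤ 1 - 1 / p := min_le_left _ _
  have hθ2 : θ ≤ 1 / p - 1 / 2 := min_le_right _ _
  have hθ : 0 < θ := by
    have h1 : 1 / p < 1 := by rw [div_lt_one hp0]; exact hp1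
    have h2 : 1 / 2 < 1 / p := one_div_lt_one_div_of_lt hp0 hp2
    exact lt_min (by linarith) (by linarith)
  have hp'inv : 1 / p' = 1 - 1 / p := by
    have := hpp'.inv_add_inv_eq_one
    rw [one_div, one_div]; linarith
  set N : ℤ → ℝ≥0∞ := fun j => (2 + 2 * K) * 2 ^ (-(θ * |(j : ℝ)|)) with hN
  have hNfin : ∑' j, N j ≠ ∞ := by
    rw [ENNReal.tsum_mul_left]
    exact ENNReal.mul_ne_top (by finiteness) (ENNReal.tsum_two_rpow_neg_abs_ne_top hθ)
  refine ⟨2 ^ (1 / p') * (∑' j, N j) * 2 ^ (1 / p), by finiteness, fun f g hf hI hg => ?_⟩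
  set c := fun k : ℤ => rearrangement μ f (2 ^ k) with hc
  set b : ℤ → ℝ≥0∞ := fun k => 2 ^ (k / p : ℝ) * c k with hb
  have key : ∀ m : ℤ, 2 ^ (-m / p' : ℝ) * rearrangement ν g (2 ^ (-m)) ≤ ∑' k, N (m - k) * b k := by
    intro m
    -- Cutting at `f^*(1/t)` with `t = 2^{-m}` makes the resulting exponents depend on `m - k`
    -- alone.
    have h1 := hg (c m) (2 ^ (-m)) (by positivity)
    have hA := lintegral_enorm_gt_dyadic_le (μ := μ) hf m
    have hB := lintegral_enorm_sq_le_dyadic_le hf hp0 hI m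
    set SB := ∑' k : ℤ, if m ≤ k then rearrangement μ f (2 ^ k) * 2 ^ ((k + 1) / 2 : ℝ) else 0
    have hB' : ((∫⁻ x in {x | ‖f x‖ₑ ≤ c m}, ‖f x‖ₑ ^ 2 ∂μ) /
        ENNReal.ofReal (2 ^ (-m))) ^ (1 / 2 : ℝ) ≤ SB * 2 ^ (m / 2 : ℝ) := by
      rw [ENNReal.ofReal_two_zpow, Int.cast_neg, ENNReal.rpow_neg, div_eq_mul_inv, inv_inv]
      calc _ ≤ (SB ^ 2 * 2 ^ (m : ℝ)) ^ (1 / 2 : ℝ) := by gcongr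
        _ = _ := by
          rw [ENNReal.mul_rpow_of_nonneg _ _ (by norm_num), ← ENNReal.rpow_natCast,
            ← ENNReal.rpow_mul, ← ENNReal.rpow_mul]
          norm_num
          ring_nf
    calc _ ≤ 2 ^ (-m / p' : ℝ) * ((∑' k : ℤ, if k < m then c k * 2 ^ (k + 1 : ℝ) else 0) +
            K * (SB * 2 ^ (m / 2 : ℝ))) := by
          gcongr
          exact h1.trans (by gcongr)
      _ = ∑' k : ℤ, 2 ^ (-m / p' : ℝ) * ((if k < m then c k * 2 ^ (k + 1 : ℝ) else 0) +
            K * ((if m ≤ k then c k * 2 ^ ((k + 1) / 2 : ℝ) else 0) * 2 ^ (m / 2 : ℝ))) := by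
          rw [ENNReal.tsum_mul_left, ENNReal.tsum_add, ENNReal.tsum_mul_left,
            ENNReal.tsum_mul_right]
      _ ≤ _ := by
          refine ENNReal.tsum_le_tsum fun k => ?_
          by_cases hk : k < m
          · have hk' : (k : ℝ) < m := by exact_mod_cast hk
            simp only [hk, not_le.2 hk, if_true, if_false, zero_mul, mul_zero, add_zero, hN, hb]
            calc (2 : ℝ≥0∞) ^ (-m / p' : ℝ) * (c k * 2 ^ (k + 1 : ℝ))
                = 2 * 2 ^ (-m / p' + k - k / p : ℝ) * (2 ^ (k / p : ℝ) * c k) := by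
                  rw [sub_eq_add_neg, ENNReal.two_rpow_add, ENNReal.two_rpow_add,
                    ENNReal.two_rpow_add, ENNReal.rpow_one]
                  have : (2 : ℝ≥0∞) ^ (-(k / p) : ℝ) * 2 ^ (k / p : ℝ) = 1 := by
                    rw [← ENNReal.two_rpow_add]; simp
                  calc _ = 2 * (2 ^ (-m / p' : ℝ) * 2 ^ (k : ℝ)) * c k * 1 := by ring
                    _ = _ := by rw [← this]; ring
              _ ≤ _ := by
                  gcongr
                  · exact le_self_add
                  · norm_num
                  · rw [abs_of_pos (by push_cast; linarith)]
                    have e1 : (-m / p' : ℝ) = -(m * (1 - 1 / p)) := by rw [← hp'inv]; ring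
                    have e2 : (k / p : ℝ) = k * (1 / p) := by ring
                    have e3 := mul_le_mul_of_nonneg_right hθ1 (sub_nonneg.2 hk'.le)
                    rw [e1, e2]
                    push_cast
                    linarith
          · have hk' : (m : ℝ) ≤ k := by exact_mod_cast not_lt.1 hk
            simp only [hk, not_lt.1 hk, if_true, if_false, zero_add, hN, hb]
            calc (2 : ℝ≥0∞) ^ (-m / p' : ℝ) * (K * (c k * 2 ^ ((k + 1) / 2 : ℝ) * 2 ^ (m / 2 : ℝ)))
                = (2 ^ (1 / 2 : ℝ) * K) * 2 ^ (-m / p' + k / 2 + m / 2 - k / p : ℝ)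
                    * (2 ^ (k / p : ℝ) * c k) := by
                  rw [sub_eq_add_neg, add_div, ENNReal.two_rpow_add, ENNReal.two_rpow_add,
                    ENNReal.two_rpow_add, ENNReal.two_rpow_add]
                  have : (2 : ℝ≥0∞) ^ (-(k / p) : ℝ) * 2 ^ (k / p : ℝ) = 1 := by
                    rw [← ENNReal.two_rpow_add]; simp
                  calc _ = 2 ^ (1 / 2 : ℝ) * K * (2 ^ (-m / p' : ℝ) * 2 ^ (k / 2 : ℝ) *
                        2 ^ (m / 2 : ℝ)) * c k * 1 := by ring
                    _ = _ := by rw [← this]; ring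
              _ ≤ _ := by
                  gcongr
                  · refine le_trans ?_ le_add_self
                    gcongr
                    calc (2 : ℝ≥0∞) ^ (1 / 2 : ℝ) ≤ 2 ^ (1 : ℝ) :=
                          ENNReal.rpow_le_rpow_of_exponent_le (by norm_num) (by norm_num)
                      _ = 2 := ENNReal.rpow_one _
                  · norm_num
                  · rw [abs_of_nonpos (by push_cast; linarith)]
                    have e1 : (-m / p' : ℝ) = -(m * (1 - 1 / p)) := by rw [← hp'inv]; ring
                    have e2 : (k / p : ℝ) = k * (1 / p) := by ring
                    have e3 := mul_le_mul_of_nonneg_right hθ2 (sub_nonneg.2 hk')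
                    rw [e1, e2]
                    push_cast
                    linarith
  have hsum : lorentzENorm ν p' p g ^ p ≤
      (2 ^ (1 / p') * (∑' j, N j) * 2 ^ (1 / p) * (∫⁻ x, ‖f x‖ₑ ^ p ∂μ) ^ (1 / p)) ^ p := by
    calc _ ≤ _ := lorentzENorm_rpow_le_tsum_dyadic hp'0 hp0 g
      _ = ∑' m : ℤ, (2 ^ (1 / p' : ℝ) *
            (2 ^ (-m / p' : ℝ) * rearrangement ν g (2 ^ (-m)))) ^ p := by
          rw [← (Equiv.neg ℤ).tsum_eq]
          refine tsum_congr fun m => ?_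
          rw [← mul_assoc, ← ENNReal.two_rpow_add, Equiv.neg_apply, ← add_div, Int.cast_neg,
            add_comm (1 : ℝ)]
      _ ≤ ∑' m : ℤ, (2 ^ (1 / p' : ℝ)) ^ p * (∑' k, N (m - k) * b k) ^ p := by
          refine ENNReal.tsum_le_tsum fun m => ?_
          rw [← ENNReal.mul_rpow_of_nonneg _ _ hp0.le]
          gcongr
          exact key m
      _ ≤ (2 ^ (1 / p' : ℝ)) ^ p * ((∑' j, N j) ^ p * (2 * ∫⁻ x, ‖f x‖ₑ ^ p ∂μ)) := by
          rw [ENNReal.tsum_mul_left]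
          gcongr
          refine (ENNReal.tsum_conv_rpow_le hp1 N b).trans ?_
          gcongr
          exact tsum_dyadic_rearrangement_le hf hp0
      _ = _ := by
          simp only [ENNReal.mul_rpow_of_nonneg _ _ hp0.le, ← ENNReal.rpow_mul,
            one_div_mul_cancel hp0.ne', ENNReal.rpow_one]
          ring
  exact (ENNReal.rpow_le_rpow_iff hp0).1 hsum

end Interpolation

open scoped FourierTransform SchwartzMap

/-! ### Agreement of the Plancherel transform with the Fourier integral. -/

section Plancherel

variable {V : Type*} [NormedAddCommGroup V] [InnerProductSpace ℝ V] [FiniteDimensional ℝ V]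
  [MeasurableSpace V] [BorelSpace V]

lemma continuous_fourier_of_integrable {f : V → ℂ} (hf : Integrable f) : Continuous (𝓕 f) :=
  VectorFourier.fourierIntegral_continuous Real.continuous_fourierChar
    (by exact continuous_inner) hf

lemma integral_fourier_smul_eq_of_integrable {f g : V → ℂ} (hf : Integrable f)
    (hg : Integrable g) : ∫ x, 𝓕 g x • f x = ∫ x, g x • 𝓕 f x := by
  have := VectorFourier.integral_fourierIntegral_smul_eq_flip (L := innerₗ V)
    Real.continuous_fourierChar (by exact continuous_inner) hg hf
  rwa [flip_innerₗ] at this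

/-- On `L¹ ∩ L²` the Plancherel transform is given by the Fourier integral. -/
lemma fourier_toLp_two_ae_eq {f : V → ℂ} (hf : Integrable f) (hf2 : MemLp f 2) :
    (𝓕 (hf2.toLp f) : Lp ℂ 2 (volume : Measure V)) =ᵐ[volume] 𝓕 f := by
  set u : Lp ℂ 2 (volume : Measure V) := 𝓕 (hf2.toLp f) with hu
  have hcont := continuous_fourier_of_integrable hf
  have hul : LocallyIntegrable u volume := (Lp.memLp u).locallyIntegrable (by norm_num)
  have hfl : LocallyIntegrable (𝓕 f) volume := hcont.locallyIntegrable
  suffices h : ∀ᵐ x, (u - 𝓕 f : V → ℂ) x = 0 by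
    filter_upwards [h] with x hx
    exact sub_eq_zero.1 hx
  -- Both functions are locally integrable, so it suffices to test against smooth compactly
  -- supported `g`. Duality moves the transform onto the Schwartz function `φ`, in the tempered
  -- sense for `u` and by Fubini for the integral.
  refine ae_eq_zero_of_integral_contDiff_smul_eq_zero (hul.sub hfl) fun g hg hgc => ?_
  have hg₁ : HasCompactSupport (Complex.ofRealCLM ∘ g) := hgc.comp_left rfl
  have hg₂ : ContDiff ℝ ((⊤ : ℕ∞) : WithTop ℕ∞) (Complex.ofRealCLM ∘ g) := by fun_prop
  set φ : 𝓢(V, ℂ) := hg₁.toSchwartzMap hg₂ with hφ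
  have hφx : ∀ x, φ x = (g x : ℂ) := fun x => rfl
  have h1 : ∫ x, φ x • u x = ∫ x, 𝓕 φ x • f x := by
    rw [← Lp.toTemperedDistribution_apply, hu, ← Lp.fourier_toTemperedDistribution_eq,
      TemperedDistribution.fourier_apply, Lp.toTemperedDistribution_apply]
    refine integral_congr_ae ?_
    filter_upwards [hf2.coeFn_toLp] with x hx
    rw [hx]
  have h2 : ∫ x, 𝓕 φ x • f x = ∫ x, φ x • 𝓕 f x := by
    rw [SchwartzMap.fourier_coe]
    exact integral_fourier_smul_eq_of_integrable hf φ.integrable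
  have hi1 : Integrable fun x => g x • u x := hul.integrable_smul_left_of_hasCompactSupport
    hg.continuous hgc
  have hi2 : Integrable fun x => g x • 𝓕 f x := hfl.integrable_smul_left_of_hasCompactSupport
    hg.continuous hgc
  have h3 : ∫ x, g x • u x = ∫ x, g x • 𝓕 f x := by
    simpa only [hφx, Complex.real_smul, smul_eq_mul] using h1.trans h2
  simp only [Pi.sub_apply, smul_sub]
  rw [integral_sub hi1 hi2, h3, sub_self]

end Plancherel

/-! ### The Fourier transform on `L¹ + L²`. -/

section FourierOperator

variable {d : ℕ}

/-- The kernel of `𝓕` is `e^{-2πi⟨x,t⟩}`; this is the origin of every factor `2π` below. -/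
lemma fourierIntegralFun_eq_fourier (f : EuclideanSpace ℝ (Fin d) → ℂ)
    (x : EuclideanSpace ℝ (Fin d)) :
    fourierIntegralFun f x = 𝓕 f ((2 * Real.pi)⁻¹ • x) := by
  rw [fourierIntegralFun, Real.fourier_eq']
  refine integral_congr_ae (Filter.Eventually.of_forall fun t => ?_)
  simp only [smul_eq_mul]
  rw [mul_comm, inner_smul_right, real_inner_comm x t]
  congr 2
  have : -2 * Real.pi * ((2 * Real.pi)⁻¹ * inner ℝ x t) = -inner ℝ x t := by
    field_simp [Real.pi_ne_zero]
  rw [this]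
  push_cast
  ring

/-- Lets almost-everywhere identities for `𝓕` survive the rescaling of the variable. -/
lemma quasiMeasurePreserving_smul_euclidean {c : ℝ} (hc : c ≠ 0) :
    Measure.QuasiMeasurePreserving (fun x : EuclideanSpace ℝ (Fin d) => c • x) volume volume := by
  refine ⟨by fun_prop, ?_⟩
  rw [Measure.map_addHaar_smul _ hc]
  exact Measure.smul_absolutelyContinuous

lemma lintegral_comp_smul_euclidean {c : ℝ} (hc : c ≠ 0)
    (F : EuclideanSpace ℝ (Fin d) → ℝ≥0∞) :
    ∫⁻ x, F (c • x) = ENNReal.ofReal |(c ^ d)⁻¹| * ∫⁻ x, F x := by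
  have h := (Homeomorph.smulOfNeZero c hc).measurableEmbedding.lintegral_map
    (μ := (volume : Measure (EuclideanSpace ℝ (Fin d)))) F
  have h' := Measure.map_addHaar_smul (volume : Measure (EuclideanSpace ℝ (Fin d))) hc
  simp only [Homeomorph.smulOfNeZero_apply] at h
  rw [← h]
  rw [h', lintegral_smul_measure]
  simp

/-- `g` is the Fourier transform of `f ∈ L¹ + L²`: the sum of the Fourier integral of the
`L¹`-part and the Plancherel transform of the `L²`-part. -/
def IsFourierOf (f g : EuclideanSpace ℝ (Fin d) → ℂ) : Prop :=
  ∃ (f₁ : EuclideanSpace ℝ (Fin d) → ℂ) (f₂ : Lp ℂ 2 (volume : Measure (EuclideanSpace ℝ (Fin d)))),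
    Integrable f₁ ∧ f =ᵐ[volume] f₁ + f₂ ∧
      g =ᵐ[volume] fun x => fourierIntegralFun f₁ x +
        (𝓕 f₂ : Lp ℂ 2 (volume : Measure (EuclideanSpace ℝ (Fin d)))) ((2 * Real.pi)⁻¹ • x)

lemma two_pi_inv_ne_zero : (2 * Real.pi)⁻¹ ≠ 0 := by positivity

lemma continuous_fourierIntegralFun {f : EuclideanSpace ℝ (Fin d) → ℂ} (hf : Integrable f) :
    Continuous (fourierIntegralFun f) := by
  rw [show fourierIntegralFun f = fun x => 𝓕 f ((2 * Real.pi)⁻¹ • x) from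
    funext (fourierIntegralFun_eq_fourier f)]
  exact (continuous_fourier_of_integrable hf).comp (continuous_const_smul (2 * Real.pi)⁻¹)

lemma integrable_fourierIntegralFun_integrand {f : EuclideanSpace ℝ (Fin d) → ℂ}
    (hf : Integrable f) (x : EuclideanSpace ℝ (Fin d)) :
    Integrable fun t => f t * Complex.exp (-(Complex.I * ((inner ℝ x t : ℝ) : ℂ))) := by
  refine hf.mul_bdd (c := 1) (by fun_prop) (Filter.Eventually.of_forall fun t => ?_)
  have : -(Complex.I * ((inner ℝ x t : ℝ) : ℂ)) = ((-inner ℝ x t : ℝ) : ℂ) * Complex.I := by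
    push_cast; ring
  rw [this, Complex.norm_exp_ofReal_mul_I]

lemma fourierIntegralFun_add {f g : EuclideanSpace ℝ (Fin d) → ℂ} (hf : Integrable f)
    (hg : Integrable g) :
    fourierIntegralFun (f + g) = fourierIntegralFun f + fourierIntegralFun g := by
  ext x
  simp only [fourierIntegralFun, Pi.add_apply, add_mul]
  exact integral_add (integrable_fourierIntegralFun_integrand hf x)
    (integrable_fourierIntegralFun_integrand hg x)

lemma fourierIntegralFun_smul (c : ℂ) (f : EuclideanSpace ℝ (Fin d) → ℂ) :
    fourierIntegralFun (c • f) = c • fourierIntegralFun f := by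
  ext x
  simp only [fourierIntegralFun, Pi.smul_apply, smul_eq_mul, mul_assoc]
  exact integral_const_mul c _

lemma fourierIntegralFun_congr {f g : EuclideanSpace ℝ (Fin d) → ℂ} (h : f =ᵐ[volume] g) :
    fourierIntegralFun f = fourierIntegralFun g := by
  ext x
  refine integral_congr_ae ?_
  filter_upwards [h] with t ht
  rw [ht]

lemma enorm_fourierIntegralFun_le (f : EuclideanSpace ℝ (Fin d) → ℂ)
    (x : EuclideanSpace ℝ (Fin d)) : ‖fourierIntegralFun f x‖ₑ ≤ ∫⁻ t, ‖f t‖ₑ := by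
  refine (enorm_integral_le_lintegral_enorm _).trans (lintegral_mono fun t => ?_)
  have : -(Complex.I * ((inner ℝ x t : ℝ) : ℂ)) = ((-inner ℝ x t : ℝ) : ℂ) * Complex.I := by
    push_cast; ring
  rw [enorm_mul, this, ← ofReal_norm (Complex.exp _), Complex.norm_exp_ofReal_mul_I]
  simp

namespace IsFourierOf

variable {f f' g g' : EuclideanSpace ℝ (Fin d) → ℂ}

lemma aestronglyMeasurable (h : IsFourierOf f g) : AEStronglyMeasurable g volume := by
  obtain ⟨f₁, f₂, h1, -, h3⟩ := h
  refine AEStronglyMeasurable.congr ?_ h3.symm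
  exact (continuous_fourierIntegralFun h1).aestronglyMeasurable.add
    ((Lp.aestronglyMeasurable _).comp_quasiMeasurePreserving
      (quasiMeasurePreserving_smul_euclidean two_pi_inv_ne_zero))

lemma add (h : IsFourierOf f g) (h' : IsFourierOf f' g') : IsFourierOf (f + f') (g + g') := by
  obtain ⟨f₁, f₂, h1, h2, h3⟩ := h
  obtain ⟨k₁, k₂, k1, k2, k3⟩ := h'
  refine ⟨f₁ + k₁, f₂ + k₂, h1.add k1, ?_, ?_⟩
  · filter_upwards [h2, k2, Lp.coeFn_add f₂ k₂] with x hx kx hs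
    simp only [Pi.add_apply] at *
    rw [hx, kx, hs]
    ring
  · rw [FourierTransform.fourier_add, fourierIntegralFun_add h1 k1]
    filter_upwards [h3, k3, (quasiMeasurePreserving_smul_euclidean two_pi_inv_ne_zero).ae_eq_comp
      (Lp.coeFn_add (𝓕 f₂) (𝓕 k₂))] with x hx kx hs
    simp only [Pi.add_apply, Function.comp_apply] at *
    rw [hx, kx, hs]; ring

lemma smul (c : ℂ) (h : IsFourierOf f g) : IsFourierOf (c • f) (c • g) := by
  obtain ⟨f₁, f₂, h1, h2, h3⟩ := h
  refine ⟨c • f₁, c • f₂, h1.smul c, ?_, ?_⟩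
  · filter_upwards [h2, Lp.coeFn_smul c f₂] with x hx hs
    simp only [Pi.add_apply, Pi.smul_apply] at *
    rw [hx, hs, smul_add]
  · rw [FourierTransform.fourier_smul, fourierIntegralFun_smul]
    filter_upwards [h3, (quasiMeasurePreserving_smul_euclidean two_pi_inv_ne_zero).ae_eq_comp
      (Lp.coeFn_smul c (𝓕 f₂))] with x hx hs
    simp only [Pi.smul_apply, Function.comp_apply] at *
    rw [hx, hs, smul_add]

/-- If `f₁ + f₂ = 0` almost everywhere, then `f₂ = -f₁` lies in `L¹ ∩ L²`, where the two transforms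
agree and hence cancel. By linearity the transform does not depend on the decomposition. -/
lemma ae_eq_zero (h : IsFourierOf f g) (hf : f =ᵐ[volume] 0) : g =ᵐ[volume] 0 := by
  obtain ⟨f₁, f₂, h1, h2, h3⟩ := h
  have hneg : (f₂ : EuclideanSpace ℝ (Fin d) → ℂ) =ᵐ[volume] (-1 : ℂ) • f₁ := by
    filter_upwards [h2, hf] with x hx h0
    simp only [Pi.add_apply, Pi.zero_apply, Pi.smul_apply, smul_eq_mul] at *
    rw [h0] at hx
    linear_combination -hx
  have hmem : MemLp ((-1 : ℂ) • f₁) 2 volume := (memLp_congr_ae hneg).1 (Lp.memLp f₂)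
  have hf₂ : f₂ = hmem.toLp _ := Lp.ext (hneg.trans hmem.coeFn_toLp.symm)
  have key := (quasiMeasurePreserving_smul_euclidean (d := d) two_pi_inv_ne_zero).ae_eq_comp
    (fourier_toLp_two_ae_eq (h1.smul (-1 : ℂ)) hmem)
  rw [← hf₂] at key
  filter_upwards [h3, key] with x hx kx
  simp only [Function.comp_apply] at kx
  rw [hx, kx, ← fourierIntegralFun_eq_fourier, fourierIntegralFun_smul]
  simp

lemma unique (h : IsFourierOf f g) (h' : IsFourierOf f' g') (hf : f =ᵐ[volume] f') :
    g =ᵐ[volume] g' := by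
  have := (h.add (h'.smul (-1))).ae_eq_zero (by
    filter_upwards [hf] with x hx
    simp [hx])
  filter_upwards [this] with x hx
  simp only [Pi.add_apply, Pi.smul_apply, smul_eq_mul, Pi.zero_apply] at hx
  linear_combination hx

lemma of_integrable (hf : Integrable f) : IsFourierOf f (fourierIntegralFun f) := by
  refine ⟨f, 0, hf, ?_, ?_⟩
  · filter_upwards [Lp.coeFn_zero ℂ 2 (volume : Measure (EuclideanSpace ℝ (Fin d)))] with x hx
    rw [Pi.add_apply, hx, Pi.zero_apply, add_zero]
  · rw [FourierTransform.fourier_zero]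
    filter_upwards [(quasiMeasurePreserving_smul_euclidean (d := d) two_pi_inv_ne_zero).ae_eq_comp
      (Lp.coeFn_zero ℂ 2 (volume : Measure (EuclideanSpace ℝ (Fin d))))] with x hx
    rw [Function.comp_apply, Function.comp_apply, Pi.zero_apply] at hx
    rw [hx, add_zero]

end IsFourierOf

end FourierOperator

/-! ### Paley's inequality and the Fourier operator. -/

section FourierBound

/-- A bounded summand only shifts levels, so `t` need not be halved as in the general inequality for
sums. -/
lemma rearrangement_add_le_of_enorm_le {α : Type*} [MeasurableSpace α] {μ : Measure α}
    {u v : α → ℂ} {A : ℝ≥0∞} (hu : ∀ x, ‖u x‖ₑ ≤ A) (t : ℝ) :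
    rearrangement μ (u + v) t ≤ A + rearrangement μ v t := by
  refine rearrangement_le_of_distribution_le
    (le_trans (measure_mono fun x hx => ?_) (distribution_rearrangement_le μ v t))
  have hx : A + rearrangement μ v t < ‖u x + v x‖ₑ := hx
  rw [mem_ofPred_eq]
  refine lt_of_not_ge fun h => absurd hx (not_lt.2 ?_)
  exact (enorm_add_le _ _).trans (add_le_add (hu x) h)

variable {d : ℕ}

lemma lintegral_enorm_sq_fourier (f : Lp ℂ 2 (volume : Measure (EuclideanSpace ℝ (Fin d)))) :
    ∫⁻ x, ‖(𝓕 f : Lp ℂ 2 (volume : Measure (EuclideanSpace ℝ (Fin d)))) x‖ₑ ^ 2 =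
      ∫⁻ x, ‖f x‖ₑ ^ 2 := by
  have h : eLpNorm (𝓕 f : Lp ℂ 2 (volume : Measure (EuclideanSpace ℝ (Fin d)))) 2 volume
      = eLpNorm f 2 volume := by
    rw [← Lp.enorm_def, ← Lp.enorm_def, ← ofReal_norm, ← ofReal_norm, Lp.norm_fourier_eq]
  simp only [eLpNorm_eq_lintegral_rpow_enorm_toReal (p := 2) (by norm_num) (by norm_num),
    ENNReal.toReal_ofNat, ENNReal.rpow_ofNat] at h
  exact (ENNReal.rpow_left_injective (by norm_num : (1 / 2 : ℝ) ≠ 0)) h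

/-- The endpoint bounds `L¹ → L^∞` and `L² → L²`, for the rearrangement. -/
lemma rearrangement_fourier_add_le (f₁ : EuclideanSpace ℝ (Fin d) → ℂ)
    (f₂ : Lp ℂ 2 (volume : Measure (EuclideanSpace ℝ (Fin d)))) {t : ℝ} (ht : 0 < t) :
    rearrangement volume (fun x => fourierIntegralFun f₁ x +
        (𝓕 f₂ : Lp ℂ 2 (volume : Measure (EuclideanSpace ℝ (Fin d)))) ((2 * Real.pi)⁻¹ • x)) t ≤
      (∫⁻ x, ‖f₁ x‖ₑ) + ENNReal.ofReal ((2 * Real.pi) ^ d) ^ (1 / 2 : ℝ) *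
        ((∫⁻ x, ‖f₂ x‖ₑ ^ 2) / ENNReal.ofReal t) ^ (1 / 2 : ℝ) := by
  refine (rearrangement_add_le_of_enorm_le (enorm_fourierIntegralFun_le f₁) t).trans ?_
  gcongr
  set u : Lp ℂ 2 (volume : Measure (EuclideanSpace ℝ (Fin d))) := 𝓕 f₂
  have hm : AEMeasurable (fun x => u ((2 * Real.pi)⁻¹ • x)) volume :=
    ((Lp.aestronglyMeasurable u).comp_quasiMeasurePreserving
      (quasiMeasurePreserving_smul_euclidean two_pi_inv_ne_zero)).aemeasurable
  refine (rearrangement_le_lintegral_div_rpow hm two_pos ht).trans ?_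
  rw [← ENNReal.mul_rpow_of_nonneg _ _ (by norm_num), ← mul_div_assoc]
  simp only [ENNReal.rpow_ofNat]
  rw [lintegral_comp_smul_euclidean two_pi_inv_ne_zero (fun y => ‖u y‖ₑ ^ 2),
    lintegral_enorm_sq_fourier, inv_pow, inv_inv, abs_of_nonneg (by positivity)]

/-- The two parts of `f` above and below the height `s`, as an element of `L¹ + L²`. -/
lemma isFourierOf_truncation {f : EuclideanSpace ℝ (Fin d) → ℂ} (hf : Measurable f) (s : ℝ≥0∞)
    (hA : ∫⁻ x in {x | s < ‖f x‖ₑ}, ‖f x‖ₑ ≠ ∞) (hB : ∫⁻ x in {x | ‖f x‖ₑ ≤ s}, ‖f x‖ₑ ^ 2 ≠ ∞) :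
    ∃ g, IsFourierOf f g ∧ ∀ t : ℝ, 0 < t → rearrangement volume g t ≤
      (∫⁻ x in {x | s < ‖f x‖ₑ}, ‖f x‖ₑ) + ENNReal.ofReal ((2 * Real.pi) ^ d) ^ (1 / 2 : ℝ) *
        ((∫⁻ x in {x | ‖f x‖ₑ ≤ s}, ‖f x‖ₑ ^ 2) / ENNReal.ofReal t) ^ (1 / 2 : ℝ) := by
  have hSA : MeasurableSet {x | s < ‖f x‖ₑ} := measurableSet_lt measurable_const (by fun_prop)
  have hSB : MeasurableSet {x | ‖f x‖ₑ ≤ s} := measurableSet_le (by fun_prop) measurable_const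
  set f₁ := {x | s < ‖f x‖ₑ}.indicator f with hf₁
  set f₂ := {x | ‖f x‖ₑ ≤ s}.indicator f with hf₂
  have e1 : ∫⁻ x, ‖f₁ x‖ₑ = ∫⁻ x in {x | s < ‖f x‖ₑ}, ‖f x‖ₑ := by
    rw [← lintegral_indicator hSA]
    exact lintegral_congr fun x => enorm_indicator_eq_indicator_enorm _ _
  have e2 : ∫⁻ x, ‖f₂ x‖ₑ ^ 2 = ∫⁻ x in {x | ‖f x‖ₑ ≤ s}, ‖f x‖ₑ ^ 2 := by
    rw [← lintegral_indicator hSB]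
    refine lintegral_congr fun x => ?_
    by_cases hx : x ∈ {x | ‖f x‖ₑ ≤ s} <;> simp [hf₂, indicator, hx]
  have h1 : Integrable f₁ := ⟨(hf.indicator hSA).aestronglyMeasurable, by
    rw [HasFiniteIntegral, e1]; exact hA.lt_top⟩
  have h2 : MemLp f₂ 2 := ⟨(hf.indicator hSB).aestronglyMeasurable, by
    rw [eLpNorm_lt_top_iff_lintegral_rpow_enorm_lt_top (by norm_num) (by norm_num)]
    simp only [ENNReal.toReal_ofNat, ENNReal.rpow_ofNat, e2]
    exact hB.lt_top⟩
  refine ⟨_, ⟨f₁, h2.toLp f₂, h1, ?_, Filter.EventuallyEq.rfl⟩, fun t ht => ?_⟩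
  · filter_upwards [h2.coeFn_toLp] with x hx
    rw [Pi.add_apply, hx]
    by_cases h : ‖f x‖ₑ ≤ s
    · simp [hf₁, hf₂, h, not_lt.2 h]
    · simp [hf₁, hf₂, h, not_le.1 h]
  · have e3 : ∫⁻ x, ‖h2.toLp f₂ x‖ₑ ^ 2 = ∫⁻ x, ‖f₂ x‖ₑ ^ 2 := by
      refine lintegral_congr_ae ?_
      filter_upwards [h2.coeFn_toLp] with x hx
      rw [hx]
    rw [← e1, ← e2, ← e3]
    exact rearrangement_fourier_add_le f₁ (h2.toLp f₂) ht

/-- Cut at height `1`: `|f| ≤ |f|^p` above it and `|f|² ≤ |f|^p` below it. -/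
lemma exists_isFourierOf {f : EuclideanSpace ℝ (Fin d) → ℂ} (hf : Measurable f) {p : ℝ}
    (hp1 : 1 ≤ p) (hp2 : p ≤ 2) (hI : ∫⁻ x, ‖f x‖ₑ ^ p ≠ ∞) : ∃ g, IsFourierOf f g := by
  have hSA : MeasurableSet {x | 1 < ‖f x‖ₑ} := measurableSet_lt measurable_const (by fun_prop)
  have hSB : MeasurableSet {x | ‖f x‖ₑ ≤ 1} := measurableSet_le (by fun_prop) measurable_const
  obtain ⟨g, hg, -⟩ := isFourierOf_truncation hf 1
    (ne_top_of_le_ne_top hI <| (setLIntegral_mono' hSA fun x hx => by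
      have hx : 1 < ‖f x‖ₑ := hx
      calc ‖f x‖ₑ = ‖f x‖ₑ ^ (1 : ℝ) := (ENNReal.rpow_one _).symm
        _ ≤ ‖f x‖ₑ ^ p := ENNReal.rpow_le_rpow_of_exponent_le hx.le hp1).trans
      (setLIntegral_le_lintegral _ _))
    (ne_top_of_le_ne_top hI <| (setLIntegral_mono' hSB fun x hx => by
      have hx : ‖f x‖ₑ ≤ 1 := hx
      calc ‖f x‖ₑ ^ 2 = ‖f x‖ₑ ^ (2 : ℝ) := by simp
        _ ≤ ‖f x‖ₑ ^ p := ENNReal.rpow_le_rpow_of_exponent_ge hx hp2).trans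
      (setLIntegral_le_lintegral _ _))
  exact ⟨g, hg⟩

/-- The Hausdorff–Young inequality with a Lorentz target, due to Paley. -/
lemma exists_lorentzENorm_isFourierOf_le (d : ℕ) {p p' : ℝ} (hp1 : 1 < p) (hp2 : p < 2)
    (hpp' : p.HolderConjugate p') :
    ∃ C : ℝ≥0∞, C ≠ ∞ ∧ ∀ f g : EuclideanSpace ℝ (Fin d) → ℂ, Measurable f →
      ∫⁻ x, ‖f x‖ₑ ^ p ≠ ∞ → IsFourierOf f g →
        lorentzENorm volume p' p g ≤ C * (∫⁻ x, ‖f x‖ₑ ^ p) ^ (1 / p) := by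
  set K := ENNReal.ofReal ((2 * Real.pi) ^ d) ^ (1 / 2 : ℝ) with hK
  have hK0 : K ≠ 0 := (ENNReal.rpow_pos (by simp; positivity) (by finiteness)).ne'
  obtain ⟨C, hC, h⟩ := exists_lorentzENorm_le_of_rearrangement_le
    (μ := (volume : Measure (EuclideanSpace ℝ (Fin d))))
    (ν := (volume : Measure (EuclideanSpace ℝ (Fin d)))) hp1 hp2 hpp' (K := K) (by finiteness)
  refine ⟨C, hC, fun f g hf hI hg => h f g hf hI fun s t ht => ?_⟩
  -- If either truncated integral is infinite, the bound is trivial; for the second one this needs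
  -- `K ≠ 0`.
  by_cases hA : ∫⁻ x in {x | s < ‖f x‖ₑ}, ‖f x‖ₑ = ∞
  · simp [hA]
  by_cases hB : ∫⁻ x in {x | ‖f x‖ₑ ≤ s}, ‖f x‖ₑ ^ 2 = ∞
  · rw [hB, ENNReal.top_div_of_ne_top ENNReal.ofReal_ne_top,
      ENNReal.top_rpow_of_pos (by norm_num), ENNReal.mul_top hK0, add_top]
    exact le_top
  obtain ⟨g', hg', hb⟩ := isFourierOf_truncation hf s hA hB
  -- The transform `g'` is built from the cut at `s`; uniqueness identifies it with the fixed `g`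
  -- for every `s`.
  rw [rearrangement_congr (hg.unique hg' Filter.EventuallyEq.rfl)]
  exact hb t ht

variable {p : ℝ}

lemma lintegral_enorm_rpow_Lp_eq {α : Type*} [MeasurableSpace α] {μ : Measure α} (hp : 0 < p)
    (f : Lp ℂ (ENNReal.ofReal p) μ) :
    (∫⁻ x, ‖f x‖ₑ ^ p ∂μ) ^ (1 / p) = ‖f‖ₑ := by
  rw [Lp.enorm_def, eLpNorm_eq_lintegral_rpow_enorm_toReal (by simpa using hp) (by simp),
    ENNReal.toReal_ofReal hp.le]

lemma lintegral_enorm_rpow_Lp_ne_top {α : Type*} [MeasurableSpace α] {μ : Measure α} (hp : 0 < p)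
    (f : Lp ℂ (ENNReal.ofReal p) μ) : ∫⁻ x, ‖f x‖ₑ ^ p ∂μ ≠ ∞ := by
  have h := lintegral_enorm_rpow_Lp_eq hp f
  intro hI
  rw [hI, ENNReal.top_rpow_of_pos (by positivity)] at h
  exact Lp.eLpNorm_ne_top f (by rw [← Lp.enorm_def, ← h])

/-- The Fourier transform as a linear operator `L^p(ℝ^d) → L^{p',p}(ℝ^d)`. -/
lemma exists_fourierOperator (d : ℕ) {p p' : ℝ} (hp1 : 1 < p) (hp2 : p < 2)
    (hpp' : p.HolderConjugate p') [Fact (1 ≤ ENNReal.ofReal p)] :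
    ∃ T : Lp ℂ (ENNReal.ofReal p) (volume : Measure (EuclideanSpace ℝ (Fin d))) →ₗ[ℂ]
        lorentzSpace (volume : Measure (EuclideanSpace ℝ (Fin d))) hpp'.symm.pos hpp'.pos,
      IsFourierTransform T := by
  have hp0 : 0 < p := hpp'.pos
  obtain ⟨C, hC, hbound⟩ := exists_lorentzENorm_isFourierOf_le d hp1 hp2 hpp'
  have hmeas : ∀ f : Lp ℂ (ENNReal.ofReal p) (volume : Measure (EuclideanSpace ℝ (Fin d))),
      Measurable f := fun f => (Lp.stronglyMeasurable f).measurable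
  -- The choice is arbitrary for each `f`; linearity of the operator comes from uniqueness almost
  -- everywhere.
  choose G hG using fun f : Lp ℂ (ENNReal.ofReal p)
    (volume : Measure (EuclideanSpace ℝ (Fin d))) =>
    exists_isFourierOf (hmeas f) hp1.le hp2.le (lintegral_enorm_rpow_Lp_ne_top hp0 f)
  have hGb : ∀ f, lorentzENorm volume p' p (G f) ≤ C * ‖f‖ₑ := fun f => by
    rw [← lintegral_enorm_rpow_Lp_eq hp0 f]
    exact hbound f (G f) (hmeas f) (lintegral_enorm_rpow_Lp_ne_top hp0 f) (hG f)
  set Q : Lp ℂ (ENNReal.ofReal p) (volume : Measure (EuclideanSpace ℝ (Fin d))) →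
    EuclideanSpace ℝ (Fin d) →ₘ[volume] ℂ :=
    fun f => AEEqFun.mk (G f) (hG f).aestronglyMeasurable with hQ
  have hQc : ∀ f, Q f =ᵐ[volume] G f := fun f => AEEqFun.coeFn_mk _ _
  have hQb : ∀ f, lorentzENorm volume p' p (Q f) ≤ C * ‖f‖ₑ := fun f => by
    rw [lorentzENorm_congr _ _ (hQc f)]
    exact hGb f
  have hQadd : ∀ f g, Q (f + g) = Q f + Q g := fun f g => by
    refine AEEqFun.ext ?_
    filter_upwards [hQc f, hQc g, hQc (f + g), AEEqFun.coeFn_add (Q f) (Q g),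
      (hG (f + g)).unique ((hG f).add (hG g)) (Lp.coeFn_add f g)] with x h1 h2 h3 h4 h5
    rw [h3, h4, h5, Pi.add_apply, Pi.add_apply, h1, h2]
  have hQsmul : ∀ (c : ℂ) f, Q (c • f) = c • Q f := fun c f => by
    refine AEEqFun.ext ?_
    filter_upwards [hQc f, hQc (c • f), AEEqFun.coeFn_smul c (Q f),
      (hG (c • f)).unique ((hG f).smul c) (Lp.coeFn_smul c f)] with x h1 h3 h4 h5
    rw [h3, h4, h5, Pi.smul_apply, Pi.smul_apply, h1]
  have hCf : ∀ f : Lp ℂ (ENNReal.ofReal p) (volume : Measure (EuclideanSpace ℝ (Fin d))),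
      C * ‖f‖ₑ ≠ ∞ := fun f => ENNReal.mul_ne_top hC enorm_ne_top
  refine ⟨{ toFun := fun f => ⟨Q f, (hQb f).trans_lt (hCf f).lt_top⟩
            map_add' := fun f g => Subtype.ext (hQadd f g)
            map_smul' := fun c f => Subtype.ext (hQsmul c f) }, ⟨C.toReal, fun f => ?_⟩,
    fun f hf => ?_⟩
  · change (lorentzENorm volume p' p (Q f)).toReal ≤ C.toReal * ‖f‖
    rw [← toReal_enorm f, ← ENNReal.toReal_mul]
    exact ENNReal.toReal_mono (hCf f) (hQb f)
  · exact (hQc f).trans ((hG f).unique (IsFourierOf.of_integrable hf) Filter.EventuallyEq.rfl)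

end FourierBound

/-! ### The quasi-triangle inequality in Lorentz spaces. -/

section QuasiNorm

variable {α : Type*} [MeasurableSpace α] {μ : Measure α}

/-- The dyadic values of the rearrangement are controlled by the Lorentz functional. -/
lemma tsum_dyadic_le_lorentzENorm_rpow {r s : ℝ} (hr : 0 < r) (hs : 0 < s) (f : α → ℂ) :
    ∑' k : ℤ, (2 ^ (k / r : ℝ) * rearrangement μ f (2 ^ (k + 1))) ^ s ≤
      2 * lorentzENorm μ r s f ^ s := by
  rw [lorentzENorm, ← ENNReal.rpow_mul, one_div_mul_cancel hs.ne', ENNReal.rpow_one,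
    lintegral_Ioi_eq_tsum_dyadic, ← ENNReal.tsum_mul_left]
  refine ENNReal.tsum_le_tsum fun k => ?_
  have h0 : (2 : ℝ≥0∞) ^ (k : ℝ) ≠ 0 := (ENNReal.rpow_pos (by norm_num) (by norm_num)).ne'
  have h1 : (2 : ℝ≥0∞) ^ (k : ℝ) ≠ ∞ := ENNReal.rpow_ne_top_of_ne_zero (by norm_num) (by norm_num)
  calc (2 ^ (k / r : ℝ) * rearrangement μ f (2 ^ (k + 1))) ^ s
      = 2 * ∫⁻ _ in Ioc ((2 : ℝ) ^ k) (2 ^ (k + 1)),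
        (2 ^ (k / r : ℝ) * rearrangement μ f (2 ^ (k + 1))) ^ s / 2 ^ ((k + 1 : ℤ) : ℝ) := by
        rw [setLIntegral_const, volume_Ioc_dyadic, Int.cast_add, Int.cast_one,
          ENNReal.two_rpow_add, ENNReal.rpow_one]
        set X := (2 ^ (k / r : ℝ) * rearrangement μ f (2 ^ (k + 1))) ^ s
        calc X = X * ((2 ^ (k : ℝ))⁻¹ * 2 ^ (k : ℝ)) * (2⁻¹ * 2) := by
              rw [ENNReal.inv_mul_cancel h0 h1, ENNReal.inv_mul_cancel (by norm_num) (by norm_num),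
                mul_one, mul_one]
          _ = _ := by
              rw [div_eq_mul_inv, ENNReal.mul_inv (Or.inl h0) (Or.inl h1)]
              ring
    _ ≤ _ := by
        gcongr 2 * ?_
        refine setLIntegral_mono' measurableSet_Ioc fun t ht => ?_
        have ht0 : 0 < t := lt_trans (by positivity) ht.1
        rw [← ENNReal.ofReal_two_zpow (k + 1)]
        gcongr
        · rw [← ENNReal.ofReal_rpow_of_pos ht0, div_eq_mul_one_div (k : ℝ), ENNReal.rpow_mul,
            ← ENNReal.ofReal_two_zpow]
          gcongr
          exact ht.1.le
        · exact rearrangement_antitone μ f ht.2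
        · exact ht.2

/-- The quasi-triangle inequality for the Lorentz functional. -/
lemma exists_lorentzENorm_add_le (μ : Measure α) {r s : ℝ} (hr : 0 < r) (hs : 0 < s) :
    ∃ M : ℝ≥0∞, M ≠ ∞ ∧ ∀ f g : α → ℂ,
      lorentzENorm μ r s (f + g) ≤ M * (lorentzENorm μ r s f + lorentzENorm μ r s g) := by
  set N : ℝ≥0∞ := (2 ^ (3 / r)) ^ s * 2 ^ s * 4 with hN
  refine ⟨N ^ (1 / s), by finiteness, fun f g => ?_⟩
  refine (ENNReal.rpow_le_rpow_iff hs).1 ?_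
  rw [ENNReal.mul_rpow_of_nonneg _ _ hs.le, ← ENNReal.rpow_mul, one_div_mul_cancel hs.ne',
    ENNReal.rpow_one]
  have hadd : ∀ a b : ℝ≥0∞, (a + b) ^ s ≤ 2 ^ s * (a ^ s + b ^ s) := fun a b => by
    calc (a + b) ^ s ≤ (2 * max a b) ^ s := by
          gcongr
          rw [two_mul]
          exact add_le_add (le_max_left _ _) (le_max_right _ _)
      _ = 2 ^ s * (max a b) ^ s := ENNReal.mul_rpow_of_nonneg _ _ hs.le
      _ ≤ _ := by
          gcongr
          rcases le_total a b with h | h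
          · rw [max_eq_right h]; exact le_add_self
          · rw [max_eq_left h]; exact le_self_add
  calc _ ≤ _ := lorentzENorm_rpow_le_tsum_dyadic hr hs (f + g)
    _ ≤ ∑' k : ℤ, (2 ^ (3 / r)) ^ s * (2 ^ s *
          ((2 ^ (k / r : ℝ) * rearrangement μ f (2 ^ (k + 1))) ^ s +
            (2 ^ (k / r : ℝ) * rearrangement μ g (2 ^ (k + 1))) ^ s)) := by
        -- Halving `2^{k+2}` lands on `2^{k+1}`, the place occurring in the dyadic lower bound; the
        -- weight `2^{(k+3)/r}` then exceeds `2^{k/r}` by the factor `2^{3/r}`.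
        rw [← (Equiv.addRight (2 : ℤ)).tsum_eq]
        refine ENNReal.tsum_le_tsum fun k => ?_
        have h1 := rearrangement_add_le μ f g (t := (2 : ℝ) ^ (k + 2)) (by positivity)
        have h2 : (2 : ℝ) ^ (k + 2) / 2 = 2 ^ (k + 1) := by
          rw [show k + 2 = (k + 1) + 1 by ring, zpow_add_one₀ (by norm_num)]; simp
        rw [h2] at h1
        simp only [Equiv.coe_addRight]
        have e : (((k + 2 : ℤ) : ℝ) + 1) / r = 3 / r + k / r := by push_cast; ring
        rw [e, ENNReal.two_rpow_add, mul_assoc, ENNReal.mul_rpow_of_nonneg _ _ hs.le]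
        gcongr
        refine le_trans ?_ (hadd _ _)
        rw [← mul_add]
        gcongr
    _ ≤ (2 ^ (3 / r)) ^ s * (2 ^ s *
          (2 * lorentzENorm μ r s f ^ s + 2 * lorentzENorm μ r s g ^ s)) := by
        rw [ENNReal.tsum_mul_left, ENNReal.tsum_mul_left, ENNReal.tsum_add]
        gcongr
        · exact tsum_dyadic_le_lorentzENorm_rpow hr hs f
        · exact tsum_dyadic_le_lorentzENorm_rpow hr hs g
    _ ≤ (2 ^ (3 / r)) ^ s * (2 ^ s *
          (2 * (lorentzENorm μ r s f + lorentzENorm μ r s g) ^ s +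
            2 * (lorentzENorm μ r s f + lorentzENorm μ r s g) ^ s)) := by
        gcongr
        · exact le_self_add
        · exact le_add_self
    _ = _ := by rw [hN]; ring

lemma exists_norm_add_le_lorentzSpace (μ : Measure α) {r s : ℝ} (hr : 0 < r) (hs : 0 < s) :
    ∃ M : ℝ, 0 ≤ M ∧ ∀ f g : lorentzSpace μ hr hs, ‖f + g‖ ≤ M * (‖f‖ + ‖g‖) := by
  obtain ⟨M, hM, h⟩ := exists_lorentzENorm_add_le μ hr hs
  refine ⟨M.toReal, ENNReal.toReal_nonneg, fun f g => ?_⟩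
  have hf : lorentzENorm μ r s (f : α →ₘ[μ] ℂ) ≠ ∞ := ne_of_lt f.2
  have hg : lorentzENorm μ r s (g : α →ₘ[μ] ℂ) ≠ ∞ := ne_of_lt g.2
  change (lorentzENorm μ r s ((f : α →ₘ[μ] ℂ) + (g : α →ₘ[μ] ℂ) : α →ₘ[μ] ℂ)).toReal ≤
    M.toReal * ((lorentzENorm μ r s (f : α →ₘ[μ] ℂ)).toReal +
      (lorentzENorm μ r s (g : α →ₘ[μ] ℂ)).toReal)
  rw [← ENNReal.toReal_add hf hg, ← ENNReal.toReal_mul]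
  refine ENNReal.toReal_mono (by finiteness) ?_
  rw [lorentzENorm_congr _ _ (AEEqFun.coeFn_add _ _)]
  exact h _ _

end QuasiNorm

/-! ### A criterion against strict singularity. -/

section StrictlySingular

/-- A bounded operator into a quasi-normed space that is bounded below on the span of an infinite
linearly independent family is not strictly singular. -/
lemma not_isStrictlySingular_of_bounded_below {𝕜 X Y ι : Type*} [NontriviallyNormedField 𝕜]
    [NormedAddCommGroup X] [NormedSpace 𝕜 X] [AddCommMonoid Y] [Module 𝕜 Y] [Norm Y] [Infinite ι]
    {T : X →ₗ[𝕜] Y} {C K M : ℝ} (hC : 0 ≤ C) (hK : 0 ≤ K) (hM : 0 ≤ M)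
    (hT : ∀ x, ‖T x‖ ≤ C * ‖x‖) (hY : ∀ y z : Y, ‖y + z‖ ≤ K * (‖y‖ + ‖z‖))
    {u : ι → X} (hu : LinearIndependent 𝕜 u)
    (hb : ∀ x ∈ Submodule.span 𝕜 (Set.range u), ‖x‖ ≤ M * ‖T x‖) :
    ¬ IsStrictlySingular T := by
  intro hss
  set S := Submodule.span 𝕜 (Set.range u)
  -- A quasi-norm need not be continuous, so passing to the closure uses the quasi-triangle
  -- inequality and costs the factor `K`.
  have hbelow : ∀ x ∈ S.topologicalClosure, ‖x‖ ≤ M * K * ‖T x‖ := by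
    intro x hx
    have key : ∀ δ : ℝ, 0 < δ → ‖x‖ ≤ M * K * ‖T x‖ + (M * K * C + 1) * δ := by
      intro δ hδ
      obtain ⟨y, hy, hxy⟩ := Metric.mem_closure_iff.1 hx δ hδ
      rw [dist_eq_norm] at hxy
      have h1 : ‖T y‖ ≤ K * (‖T x‖ + C * δ) := by
        have : T y = T x + T (y - x) := by rw [← map_add]; congr 1; abel
        rw [this]
        refine (hY _ _).trans (mul_le_mul_of_nonneg_left (add_le_add_right ?_ _) hK)
        refine (hT _).trans (mul_le_mul_of_nonneg_left ?_ hC)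
        rw [norm_sub_rev]; exact hxy.le
      have h2 : ‖x‖ ≤ ‖y‖ + ‖x - y‖ := by
        have := norm_add_le y (x - y)
        rwa [add_sub_cancel] at this
      have h3 := (hb y hy).trans (mul_le_mul_of_nonneg_left h1 hM)
      nlinarith
    refine le_of_forall_pos_le_add fun ε hε => ?_
    have hpos : 0 < M * K * C + 1 := by positivity
    have := key (ε / (M * K * C + 1)) (by positivity)
    rwa [mul_div_cancel₀ _ hpos.ne'] at this
  have hinf : ¬ FiniteDimensional 𝕜 S.topologicalClosure := by
    intro hfin
    have hmem : ∀ i, u i ∈ S.topologicalClosure := fun i =>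
      S.le_topologicalClosure (Submodule.subset_span ⟨i, rfl⟩)
    have hli : LinearIndependent 𝕜 fun i => (⟨u i, hmem i⟩ : S.topologicalClosure) :=
      LinearIndependent.of_comp S.topologicalClosure.subtype hu
    have := hli.finite
    exact not_finite ι
  obtain ⟨x, hx, hx1, hxT⟩ := hss S.topologicalClosure S.isClosed_topologicalClosure hinf
    (1 / (2 * (M * K + 1))) (by positivity)
  have h1 := hbelow x hx
  rw [hx1] at h1
  have h2 : M * K * ‖T x‖ ≤ M * K * (1 / (2 * (M * K + 1))) :=
    mul_le_mul_of_nonneg_left hxT (by positivity)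
  have h3 : M * K * (1 / (2 * (M * K + 1))) < 1 := by
    have : 0 ≤ M * K := by positivity
    rw [mul_one_div, div_lt_one (by positivity)]
    linarith
  linarith

end StrictlySingular

/-! ### A real function with Fourier transform supported in an annulus. -/

section Annulus

variable {V : Type*} [NormedAddCommGroup V] [InnerProductSpace ℝ V] [FiniteDimensional ℝ V]
  [MeasurableSpace V] [BorelSpace V]

/-- The inverse Fourier transform of a real even function is real. -/
lemma conj_fourierInv_of_even {φ : V → ℂ} (hr : ∀ x, (starRingEnd ℂ) (φ x) = φ x)
    (he : ∀ x, φ (-x) = φ x) (w : V) : (starRingEnd ℂ) (𝓕⁻ φ w) = 𝓕⁻ φ w := by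
  rw [Real.fourierInv_eq', ← integral_conj, ← integral_neg_eq_self]
  refine integral_congr_ae (Filter.Eventually.of_forall fun v => ?_)
  simp only [smul_eq_mul, map_mul, hr, he, inner_neg_left]
  congr 1
  rw [← Complex.exp_conj, map_mul, Complex.conj_I, Complex.conj_ofReal]
  congr 1
  push_cast
  ring

/-- A rapidly decaying real function whose Fourier transform is supported in an annulus. -/
lemma exists_real_fourier_annulus (m : ℕ) :
    ∃ (ρ : V → ℝ) (C : ℝ), 0 ≤ C ∧ Continuous ρ ∧ Integrable (fun x => (ρ x : ℂ)) ∧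
      (∀ x, |ρ x| ≤ C) ∧ (∀ x, ‖x‖ ^ m * |ρ x| ≤ C) ∧
      (∀ y : V, 1 / 2 ≤ ‖y‖ → ‖y‖ ≤ 1 → 𝓕 (fun x => (ρ x : ℂ)) y = 1) ∧
      (∀ y : V, ‖y‖ ≤ 1 / 4 ∨ 2 ≤ ‖y‖ → 𝓕 (fun x => (ρ x : ℂ)) y = 0) := by
  -- The difference `b₁ - b₂` is `1` for `1/2 ≤ ‖y‖ ≤ 1` and `0` for `‖y‖ ≤ 1/4` or `‖y‖ ≥ 2`. It is
  -- real and even, so its inverse transform is real.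
  let b₁ : ContDiffBump (0 : V) := ⟨1, 2, by norm_num, by norm_num⟩
  let b₂ : ContDiffBump (0 : V) := ⟨1 / 4, 1 / 2, by norm_num, by norm_num⟩
  have hsm : ContDiff ℝ ((⊤ : ℕ∞) : WithTop ℕ∞) fun x : V => ((b₁ x - b₂ x : ℝ) : ℂ) :=
    Complex.ofRealCLM.contDiff.comp (b₁.contDiff.sub b₂.contDiff)
  have hcs : HasCompactSupport fun x : V => ((b₁ x - b₂ x : ℝ) : ℂ) :=
    (b₁.hasCompactSupport.sub b₂.hasCompactSupport).comp_left (g := ((↑) : ℝ → ℂ)) rfl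
  set φ : 𝓢(V, ℂ) := hcs.toSchwartzMap hsm with hφ
  have hφx : ∀ x, φ x = ((b₁ x - b₂ x : ℝ) : ℂ) := fun x => rfl
  set ψ : 𝓢(V, ℂ) := 𝓕⁻ φ with hψ
  have hreal : ∀ x, ((ψ x).re : ℂ) = ψ x := fun x => by
    rw [← Complex.conj_eq_iff_re, hψ, SchwartzMap.fourierInv_coe]
    refine conj_fourierInv_of_even (fun x => ?_) (fun x => ?_) x
    · rw [hφx, Complex.conj_ofReal]
    · rw [hφx, hφx, b₁.neg, b₂.neg]
  have habs : ∀ x, |(ψ x).re| = ‖ψ x‖ := fun x => by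
    rw [← hreal x, Complex.norm_real, Complex.ofReal_re, Real.norm_eq_abs]
  have hfun : (fun x => ((ψ x).re : ℂ)) = ψ := funext hreal
  have hF : 𝓕 (fun x => ((ψ x).re : ℂ)) = φ := by
    rw [hfun, ← SchwartzMap.fourier_coe, hψ, FourierTransform.fourier_fourierInv_eq]
  obtain ⟨C₀, hC₀, h₀⟩ := ψ.decay 0 0
  obtain ⟨C₁, hC₁, h₁⟩ := ψ.decay m 0
  simp only [norm_iteratedFDeriv_zero, pow_zero, one_mul] at h₀ h₁
  refine ⟨fun x => (ψ x).re, max C₀ C₁, hC₀.le.trans (le_max_left _ _),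
    Complex.continuous_re.comp ψ.continuous, by rw [hfun]; exact ψ.integrable,
    fun x => ?_, fun x => ?_, fun y h1 h2 => ?_, fun y hy => ?_⟩
  · rw [habs]; exact (h₀ x).trans (le_max_left _ _)
  · rw [habs]; exact (h₁ x).trans (le_max_right _ _)
  · rw [hF, hφx, b₁.one_of_mem_closedBall (by simpa using h2),
      b₂.zero_of_le_dist (by simpa [b₂] using h1)]
    simp
  · rw [hF, hφx]
    rcases hy with hy | hy
    · rw [b₁.one_of_mem_closedBall (by simp [b₁]; linarith),
        b₂.one_of_mem_closedBall (by simpa [b₂] using hy)]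
      simp
    · rw [b₁.zero_of_le_dist (by simpa [b₁] using hy),
        b₂.zero_of_le_dist (by simp [b₂]; linarith)]
      simp

end Annulus

/-! ### Two-sided `ℓ^p` estimates for the dilates. -/

section Dilates

lemma ENNReal.ofReal_two_rpow (x : ℝ) : ENNReal.ofReal ((2 : ℝ) ^ x) = 2 ^ x := by
  rw [← ENNReal.ofReal_rpow_of_pos (by norm_num)]
  simp

variable {d : ℕ}

/-- The dilates of `ρ` by powers of `8`, normalized in `L^p(ℝ^d)`. -/
noncomputable def lpDilate (p : ℝ) (ρ : EuclideanSpace ℝ (Fin d) → ℝ) (k : ℤ)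
    (x : EuclideanSpace ℝ (Fin d)) : ℝ :=
  2 ^ (-(3 * d * k / p) : ℝ) * ρ ((2 : ℝ) ^ (-(3 * k) : ℝ) • x)

lemma continuous_lpDilate {p : ℝ} {ρ : EuclideanSpace ℝ (Fin d) → ℝ} (hρ : Continuous ρ) (k : ℤ) :
    Continuous (lpDilate p ρ k) :=
  continuous_const.mul (hρ.comp (continuous_const_smul _))

lemma integrable_lpDilate {p : ℝ} {ρ : EuclideanSpace ℝ (Fin d) → ℝ}
    (hρ : Integrable fun x => (ρ x : ℂ)) (k : ℤ) :
    Integrable fun x => (lpDilate p ρ k x : ℂ) := by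
  simp only [lpDilate, Complex.ofReal_mul]
  exact ((integrable_comp_smul_iff volume (fun x => (ρ x : ℂ)) (by positivity)).2 hρ).const_mul _

lemma two_rpow_mul_pow (x : ℝ) (d : ℕ) : ((2 : ℝ) ^ x) ^ d = 2 ^ (x * d) := by
  rw [Real.rpow_mul (by norm_num), Real.rpow_natCast]

/-- The eightfold annuli `8^m < ‖x‖ ≤ 8^(m+1)`. -/
def octadicAnnulus (d : ℕ) (m : ℤ) : Set (EuclideanSpace ℝ (Fin d)) :=
  {x | (2 : ℝ) ^ (3 * m : ℝ) < ‖x‖ ∧ ‖x‖ ≤ 2 ^ (3 * (m + 1) : ℝ)}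

lemma measurableSet_octadicAnnulus (m : ℤ) : MeasurableSet (octadicAnnulus d m) :=
  (measurableSet_lt measurable_const measurable_norm).inter
    (measurableSet_le measurable_norm measurable_const)

lemma volume_octadicAnnulus_le (m : ℤ) :
    volume (octadicAnnulus d m) ≤ 2 ^ (3 * d * (m + 1) : ℝ) *
      volume (Metric.ball (0 : EuclideanSpace ℝ (Fin d)) 1) := by
  calc _ ≤ volume (Metric.closedBall (0 : EuclideanSpace ℝ (Fin d)) (2 ^ (3 * (m + 1) : ℝ))) :=
        measure_mono fun x hx => by simpa using hx.2
    _ = _ := by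
        rw [Measure.addHaar_closedBall _ _ (by positivity), finrank_euclideanSpace_fin,
          two_rpow_mul_pow, ENNReal.ofReal_two_rpow]
        congr 2; ring

/-- The annuli miss only the origin, a null set since `d ≥ 1`. -/
lemma lintegral_le_tsum_octadicAnnulus (hd : 1 ≤ d) (F : EuclideanSpace ℝ (Fin d) → ℝ≥0∞) :
    ∫⁻ x, F x ≤ ∑' m : ℤ, ∫⁻ x in octadicAnnulus d m, F x := by
  have : Nonempty (Fin d) := ⟨⟨0, hd⟩⟩
  calc ∫⁻ x, F x = ∫⁻ x in {0}ᶜ, F x := by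
        rw [restrict_compl_singleton]
    _ ≤ ∫⁻ x in ⋃ m, octadicAnnulus d m, F x := by
        refine lintegral_mono_set fun x hx => ?_
        obtain ⟨m, h1, h2⟩ := exists_mem_Ioc_zpow (norm_pos_iff.2 hx) (by norm_num : (1 : ℝ) < 8)
        have e : ∀ m : ℤ, (8 : ℝ) ^ m = 2 ^ (3 * m : ℝ) := fun m => by
          rw [Real.rpow_mul (by norm_num), Real.rpow_intCast]; norm_num
        refine mem_iUnion.2 ⟨m, by rw [← e]; exact h1, ?_⟩
        have := e (m + 1)
        push_cast at this
        rw [← this]; exact h2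
    _ ≤ _ := lintegral_iUnion_le _ _

/-- Inside its own scale (`m ≤ k`) the dilate is controlled by boundedness of `ρ`, outside by the
decay `‖x‖^{-2d}`. The power `2d` suffices since `2d ≥ 2d/p`: one `d/p` pays for the normalization,
the other gives the decay in `m - k`. -/
lemma enorm_lpDilate_le {p : ℝ} (hp1 : 1 ≤ p) {ρ : EuclideanSpace ℝ (Fin d) → ℝ} {C : ℝ}
    (h0 : ∀ x, |ρ x| ≤ C) (h1 : ∀ x, ‖x‖ ^ (2 * d) * |ρ x| ≤ C) (k m : ℤ)
    {x : EuclideanSpace ℝ (Fin d)} (hx : x ∈ octadicAnnulus d m) :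
    ‖(lpDilate p ρ k x : ℂ)‖ₑ ≤ 2 ^ (-(3 * d * m / p) : ℝ) *
      (ENNReal.ofReal C * 2 ^ (-(3 * d / p * |((m - k : ℤ) : ℝ)|))) := by
  have hp0 : 0 < p := by linarith
  have hC : 0 ≤ C := (abs_nonneg _).trans (h0 0)
  rw [← ENNReal.ofReal_two_rpow, ← ENNReal.ofReal_two_rpow, ← ENNReal.ofReal_mul hC,
    ← ENNReal.ofReal_mul (by positivity), ← ofReal_norm, Complex.norm_real, Real.norm_eq_abs]
  refine ENNReal.ofReal_le_ofReal ?_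
  rw [lpDilate, abs_mul, abs_of_pos (by positivity : (0 : ℝ) < 2 ^ (-(3 * d * k / p) : ℝ))]
  push_cast
  rcases le_total ((m : ℝ) - k) 0 with h | h
  · rw [abs_of_nonpos h]
    calc _ ≤ (2 : ℝ) ^ (-(3 * d * k / p) : ℝ) * C := by gcongr; exact h0 _
      _ = _ := by
        rw [mul_left_comm, ← Real.rpow_add (by norm_num), mul_comm]
        congr 2; ring
  · rw [abs_of_nonneg h]
    set y := (2 : ℝ) ^ (-(3 * k) : ℝ) • x with hy
    have hyn : (2 : ℝ) ^ (3 * (m - k) : ℝ) ≤ ‖y‖ := by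
      rw [hy, norm_smul, Real.norm_of_nonneg (by positivity)]
      calc (2 : ℝ) ^ (3 * (m - k) : ℝ) = 2 ^ (-(3 * k) : ℝ) * 2 ^ (3 * m : ℝ) := by
            rw [← Real.rpow_add (by norm_num)]; congr 1; ring
        _ ≤ _ := by gcongr; exact hx.1.le
    have hρ : |ρ y| ≤ C * 2 ^ (-(6 * d * (m - k)) : ℝ) := by
      have h2 : (2 : ℝ) ^ (6 * d * (m - k) : ℝ) * |ρ y| ≤ C := by
        refine le_trans ?_ (h1 y)
        gcongr
        calc (2 : ℝ) ^ (6 * d * (m - k) : ℝ) = (2 ^ (3 * (m - k) : ℝ)) ^ (2 * d) := by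
              rw [two_rpow_mul_pow]; congr 1; push_cast; ring
          _ ≤ _ := by gcongr
      rw [Real.rpow_neg (by norm_num), ← div_eq_mul_inv, le_div_iff₀ (by positivity), mul_comm]
      exact h2
    calc _ ≤ (2 : ℝ) ^ (-(3 * d * k / p) : ℝ) * (C * 2 ^ (-(6 * d * (m - k)) : ℝ)) := by gcongr
      _ = C * 2 ^ (-(3 * d * k / p) + -(6 * d * (m - k)) : ℝ) := by
        rw [Real.rpow_add (by norm_num)]; ring
      _ ≤ C * 2 ^ (-(3 * d * m / p) + -(3 * d / p * (m - k)) : ℝ) := by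
        refine mul_le_mul_of_nonneg_left
          (Real.rpow_le_rpow_of_exponent_le (by norm_num) ?_) hC
        have hpi : 1 / p ≤ 1 := by rw [div_le_one hp0]; exact hp1
        have h3 : 0 ≤ 6 * d * ((m : ℝ) - k) * (1 - 1 / p) := by
          have : 0 ≤ 1 - 1 / p := by linarith
          positivity
        have e : (-(3 * d * m / p) + -(3 * d / p * (m - k)) : ℝ) -
            (-(3 * d * k / p) + -(6 * d * (m - k))) = 6 * d * ((m : ℝ) - k) * (1 - 1 / p) := by
          ring
        linarith
      _ = _ := by rw [Real.rpow_add (by norm_num)]; ring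

/-- Linear combinations of the dilates satisfy an upper `ℓ^p`-estimate in `L^p`. -/
lemma exists_lintegral_sum_lpDilate_le (hd : 1 ≤ d) {p : ℝ} (hp1 : 1 < p)
    {ρ : EuclideanSpace ℝ (Fin d) → ℝ} {C : ℝ} (h0 : ∀ x, |ρ x| ≤ C)
    (h1 : ∀ x, ‖x‖ ^ (2 * d) * |ρ x| ≤ C) :
    ∃ M : ℝ≥0∞, M ≠ ∞ ∧ ∀ a : ℤ →₀ ℂ,
      ∫⁻ x, ‖∑ k ∈ a.support, a k * (lpDilate p ρ k x : ℂ)‖ₑ ^ p ≤ M * ∑' k, ‖a k‖ₑ ^ p := by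
  have hp0 : 0 < p := by linarith
  have hd0 : (0 : ℝ) < d := by exact_mod_cast hd
  set N : ℤ → ℝ≥0∞ := fun j => ENNReal.ofReal C * 2 ^ (-(3 * d / p * |(j : ℝ)|)) with hN
  have hNfin : ∑' j, N j ≠ ∞ := by
    rw [ENNReal.tsum_mul_left]
    exact ENNReal.mul_ne_top (by finiteness)
      (ENNReal.tsum_two_rpow_neg_abs_ne_top (by positivity))
  set B := volume (Metric.ball (0 : EuclideanSpace ℝ (Fin d)) 1) with hB
  have hBfin : B ≠ ∞ := measure_ball_lt_top.ne
  refine ⟨2 ^ (3 * d : ℝ) * B * (∑' j, N j) ^ p, by finiteness, fun a => ?_⟩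
  have hpt : ∀ m : ℤ, ∀ x ∈ octadicAnnulus d m,
      ‖∑ k ∈ a.support, a k * (lpDilate p ρ k x : ℂ)‖ₑ ≤
        2 ^ (-(3 * d * m / p) : ℝ) * ∑' k, N (m - k) * ‖a k‖ₑ := by
    intro m x hx
    calc _ ≤ ∑ k ∈ a.support, ‖a k * (lpDilate p ρ k x : ℂ)‖ₑ := enorm_sum_le _ _
      _ ≤ ∑ k ∈ a.support, 2 ^ (-(3 * d * m / p) : ℝ) * (N (m - k) * ‖a k‖ₑ) := by
          refine Finset.sum_le_sum fun k _ => ?_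
          rw [enorm_mul, ← mul_assoc, mul_comm]
          gcongr
          exact enorm_lpDilate_le hp1.le h0 h1 k m hx
      _ ≤ ∑' k, 2 ^ (-(3 * d * m / p) : ℝ) * (N (m - k) * ‖a k‖ₑ) := ENNReal.sum_le_tsum _
      _ = _ := ENNReal.tsum_mul_left
  calc _ ≤ _ := lintegral_le_tsum_octadicAnnulus hd _
    -- The volume of the annulus cancels the `p`-th power of the weight `2^{-3dm/p}`, which leaves a
    -- pure convolution.
    _ ≤ ∑' m : ℤ, 2 ^ (3 * d : ℝ) * B * (∑' k, N (m - k) * ‖a k‖ₑ) ^ p := by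
        refine ENNReal.tsum_le_tsum fun m => ?_
        set S := ∑' k, N (m - k) * ‖a k‖ₑ
        calc _ ≤ ∫⁻ _ in octadicAnnulus d m, (2 ^ (-(3 * d * m / p) : ℝ) * S) ^ p :=
              setLIntegral_mono' (measurableSet_octadicAnnulus m) fun x hx => by
                gcongr; exact hpt m x hx
          _ = (2 ^ (-(3 * d * m / p) : ℝ) * S) ^ p * volume (octadicAnnulus d m) :=
              setLIntegral_const _ _
          _ ≤ (2 ^ (-(3 * d * m / p) : ℝ) * S) ^ p * (2 ^ (3 * d * (m + 1) : ℝ) * B) := by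
              gcongr; exact volume_octadicAnnulus_le m
          _ = (2 ^ (-(3 * d * m) : ℝ) * 2 ^ (3 * d * (m + 1) : ℝ)) * B * S ^ p := by
              rw [ENNReal.mul_rpow_of_nonneg _ _ hp0.le, ← ENNReal.rpow_mul, neg_mul,
                div_mul_cancel₀ _ hp0.ne']
              ring
          _ = _ := by
              rw [← ENNReal.two_rpow_add]
              congr 3; ring
    _ ≤ _ := by
        rw [ENNReal.tsum_mul_left, mul_assoc _ (_ ^ p)]
        gcongr
        exact ENNReal.tsum_conv_rpow_le hp1 N _

/-- The Jacobian `2^{3dk}` times the normalization `2^{-3dk/p}` gives the exponent `3dk(1 - 1/p) =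
3dk/p'`. -/
lemma fourierIntegralFun_lpDilate {p : ℝ} (ρ : EuclideanSpace ℝ (Fin d) → ℝ) (k : ℤ)
    (x : EuclideanSpace ℝ (Fin d)) :
    fourierIntegralFun (fun x => (lpDilate p ρ k x : ℂ)) x =
      ((2 ^ (3 * d * k * (1 - 1 / p) : ℝ) : ℝ) : ℂ) *
        𝓕 (fun x => (ρ x : ℂ)) (((2 : ℝ) ^ (3 * k : ℝ) * (2 * Real.pi)⁻¹) • x) := by
  rw [fourierIntegralFun_eq_fourier, mul_smul]
  set y := (2 * Real.pi)⁻¹ • x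
  rw [Real.fourier_eq, Real.fourier_eq]
  set c := (2 : ℝ) ^ (-(3 * k) : ℝ) with hc
  have hc0 : 0 < c := by positivity
  have hci : (2 : ℝ) ^ (3 * k : ℝ) = c⁻¹ := by rw [hc, Real.rpow_neg (by norm_num), inv_inv]
  have h := Measure.integral_comp_smul (volume : Measure (EuclideanSpace ℝ (Fin d)))
    (fun v => Real.fourierChar (-inner ℝ v ((2 : ℝ) ^ (3 * k : ℝ) • y)) • (ρ v : ℂ)) c
  have e : ∀ v : EuclideanSpace ℝ (Fin d),
      inner ℝ (c • v) ((2 : ℝ) ^ (3 * k : ℝ) • y) = inner ℝ v y := fun v => by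
    rw [inner_smul_left, inner_smul_right, hci]
    simp only [conj_trivial]
    field_simp
  simp only [e, finrank_euclideanSpace_fin] at h
  have e2 : |(c ^ d)⁻¹| = 2 ^ (3 * d * k : ℝ) := by
    rw [abs_of_pos (by positivity), hc, two_rpow_mul_pow, ← Real.rpow_neg (by norm_num)]
    congr 1; ring
  have e3 : (2 : ℝ) ^ (3 * d * k * (1 - 1 / p) : ℝ) =
      2 ^ (-(3 * d * k / p) : ℝ) * 2 ^ (3 * d * k : ℝ) := by
    rw [← Real.rpow_add (by norm_num)]; congr 1; ring
  rw [e2] at h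
  rw [e3, Complex.ofReal_mul, mul_assoc, ← Complex.real_smul (x := 2 ^ (3 * d * k : ℝ)), ← h,
    ← integral_const_mul]
  refine integral_congr_ae (Filter.Eventually.of_forall fun v => ?_)
  simp only [lpDilate, Complex.ofReal_mul, Circle.smul_def, smul_eq_mul]
  ring

lemma fourierIntegralFun_sum {ι : Type*} (s : Finset ι) (a : ι → ℂ)
    {f : ι → EuclideanSpace ℝ (Fin d) → ℂ} (hf : ∀ i, Integrable (f i))
    (x : EuclideanSpace ℝ (Fin d)) :
    fourierIntegralFun (fun y => ∑ i ∈ s, a i * f i y) x =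
      ∑ i ∈ s, a i * fourierIntegralFun (f i) x := by
  simp only [fourierIntegralFun, Finset.sum_mul, mul_assoc]
  rw [integral_finsetSum _ fun i _ =>
    (integrable_fourierIntegralFun_integrand (hf i) x).const_mul (a i)]
  simp only [integral_const_mul]

/-- Annuli, shrinking by the factor `8`, on which the Fourier transforms of the dilates live. -/
def frequencyAnnulus (d : ℕ) (k : ℤ) : Set (EuclideanSpace ℝ (Fin d)) :=
  (fun x => ((2 : ℝ) ^ (3 * k : ℝ) * (2 * Real.pi)⁻¹) • x) ⁻¹' {y | 1 / 2 ≤ ‖y‖ ∧ ‖y‖ ≤ 1}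

/-- The volume is a fixed positive constant times `2^{-3dk}`; `2^j` is any power of two below that
constant. Strictness is what `le_rearrangement_of_lt_measure` requires. -/
lemma exists_lt_volume_frequencyAnnulus (hd : 1 ≤ d) :
    ∃ j : ℤ, ∀ k : ℤ, ENNReal.ofReal ((2 : ℝ) ^ (j - 3 * d * k)) <
      volume (frequencyAnnulus d k) := by
  have : Nonempty (Fin d) := ⟨⟨0, hd⟩⟩
  set A : Set (EuclideanSpace ℝ (Fin d)) := {y | 1 / 2 ≤ ‖y‖ ∧ ‖y‖ ≤ 1} with hA
  have hA0 : 0 < volume A := by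
    obtain ⟨y, hy⟩ := exists_norm_eq (EuclideanSpace ℝ (Fin d)) (by norm_num : (0 : ℝ) ≤ 3 / 4)
    have hopen : IsOpen {y : EuclideanSpace ℝ (Fin d) | 1 / 2 < ‖y‖ ∧ ‖y‖ < 1} :=
      (isOpen_lt continuous_const continuous_norm).inter
        (isOpen_lt continuous_norm continuous_const)
    exact (hopen.measure_pos volume ⟨y, by simp only [mem_ofPred_eq, hy]; norm_num⟩).trans_le
      (measure_mono fun z hz => ⟨hz.1.le, hz.2.le⟩)
  have hv : 0 < ENNReal.ofReal ((2 * Real.pi) ^ d) * volume A :=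
    ENNReal.mul_pos (by simp; positivity) hA0.ne'
  obtain ⟨n, hn⟩ := ENNReal.exists_inv_two_pow_lt hv.ne'
  refine ⟨-n, fun k => ?_⟩
  rw [frequencyAnnulus, Measure.addHaar_preimage_smul _ (by positivity),
    finrank_euclideanSpace_fin, ENNReal.ofReal_two_zpow]
  have e : |(((2 : ℝ) ^ (3 * k : ℝ) * (2 * Real.pi)⁻¹) ^ d)⁻¹| =
      2 ^ (-(3 * d * k) : ℝ) * (2 * Real.pi) ^ d := by
    rw [abs_of_pos (by positivity), mul_pow, mul_inv, inv_pow, inv_inv, two_rpow_mul_pow,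
      ← Real.rpow_neg (by norm_num)]
    congr 2; ring
  rw [e, ENNReal.ofReal_mul (by positivity), ENNReal.ofReal_two_rpow,
    mul_assoc ((2 : ℝ≥0∞) ^ _)]
  have e2 : ((-(n : ℤ) - 3 * d * k : ℤ) : ℝ) = -(3 * d * k) + -n := by push_cast; ring
  rw [e2, ENNReal.two_rpow_add]
  refine (ENNReal.mul_lt_mul_iff_right ?_ ?_).2 ?_
  · exact (ENNReal.rpow_pos (by norm_num) (by norm_num)).ne'
  · exact ENNReal.rpow_ne_top_of_ne_zero (by norm_num) (by norm_num)
  · rwa [ENNReal.rpow_neg, ENNReal.rpow_natCast, ENNReal.inv_pow]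

/-- Rescaling by `8^{i-k}` with `i ≠ k` sends `1/2 ≤ ‖y‖ ≤ 1` into `‖y‖ ≤ 1/8` or `‖y‖ ≥ 4`, off the
support. This is why the ratio is `8`. -/
lemma fourier_eq_zero_of_mem_frequencyAnnulus {φ : EuclideanSpace ℝ (Fin d) → ℂ}
    (h0 : ∀ y, ‖y‖ ≤ 1 / 4 ∨ 2 ≤ ‖y‖ → φ y = 0) {i k : ℤ} (hik : i ≠ k)
    {x : EuclideanSpace ℝ (Fin d)} (hx : x ∈ frequencyAnnulus d k) :
    φ (((2 : ℝ) ^ (3 * i : ℝ) * (2 * Real.pi)⁻¹) • x) = 0 := by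
  set y := ((2 : ℝ) ^ (3 * k : ℝ) * (2 * Real.pi)⁻¹) • x with hy
  have hx : 1 / 2 ≤ ‖y‖ ∧ ‖y‖ ≤ 1 := hx
  have e : ((2 : ℝ) ^ (3 * i : ℝ) * (2 * Real.pi)⁻¹) • x = (2 : ℝ) ^ (3 * (i - k) : ℝ) • y := by
    rw [hy, smul_smul, ← mul_assoc, ← Real.rpow_add (by norm_num)]
    congr 3; ring
  rw [e]
  apply h0
  rw [norm_smul, Real.norm_of_nonneg (by positivity)]
  rcases lt_or_gt_of_ne hik with h | h
  · left
    have h' : (i : ℝ) - k ≤ -1 := by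
      have : (i : ℝ) + 1 ≤ k := by exact_mod_cast h
      linarith
    have : (2 : ℝ) ^ (3 * (i - k) : ℝ) ≤ 2 ^ (-3 : ℝ) :=
      Real.rpow_le_rpow_of_exponent_le (by norm_num) (by linarith)
    have h3 : (2 : ℝ) ^ (-3 : ℝ) = 1 / 8 := by
      rw [Real.rpow_neg (by norm_num)]; norm_num
    have := mul_le_mul (this.trans_eq h3) hx.2 (norm_nonneg y) (by norm_num)
    linarith
  · right
    have h' : 1 ≤ (i : ℝ) - k := by
      have : (k : ℝ) + 1 ≤ i := by exact_mod_cast h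
      linarith
    have : (2 : ℝ) ^ (3 : ℝ) ≤ 2 ^ (3 * (i - k) : ℝ) :=
      Real.rpow_le_rpow_of_exponent_le (by norm_num) (by linarith)
    have h3 : (2 : ℝ) ^ (3 : ℝ) = 8 := by norm_num
    nlinarith [norm_nonneg y]

/-- The Fourier transforms of linear combinations of the dilates satisfy a lower `ℓ^p`-estimate in
`L^{p',p}`. -/
lemma exists_tsum_le_lorentzENorm_fourier_sum (hd : 1 ≤ d) {p p' : ℝ}
    (hpp' : p.HolderConjugate p') {ρ : EuclideanSpace ℝ (Fin d) → ℝ}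
    (hρ : Integrable fun x => (ρ x : ℂ))
    (h1 : ∀ y : EuclideanSpace ℝ (Fin d), 1 / 2 ≤ ‖y‖ → ‖y‖ ≤ 1 → 𝓕 (fun x => (ρ x : ℂ)) y = 1)
    (h0 : ∀ y : EuclideanSpace ℝ (Fin d), ‖y‖ ≤ 1 / 4 ∨ 2 ≤ ‖y‖ →
      𝓕 (fun x => (ρ x : ℂ)) y = 0) :
    ∃ M : ℝ≥0∞, M ≠ ∞ ∧ ∀ a : ℤ →₀ ℂ,
      ∑' k, ‖a k‖ₑ ^ p ≤ M * lorentzENorm volume p' p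
        (fourierIntegralFun fun x => ∑ k ∈ a.support, a k * (lpDilate p ρ k x : ℂ)) ^ p := by
  have hp0 : 0 < p := hpp'.pos
  have hp'0 : 0 < p' := hpp'.symm.pos
  have hp'inv : 1 - 1 / p = 1 / p' := by
    have := hpp'.inv_add_inv_eq_one
    rw [one_div, one_div]; linarith
  obtain ⟨j, hj⟩ := exists_lt_volume_frequencyAnnulus hd
  refine ⟨((2 : ℝ≥0∞) ^ (-((j - 1) / p') : ℝ)) ^ p * 2,
    ENNReal.mul_ne_top (ENNReal.rpow_ne_top_of_nonneg hp0.le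
      (ENNReal.rpow_ne_top_of_ne_zero (by norm_num) (by norm_num))) (by norm_num), fun a => ?_⟩
  set g := fourierIntegralFun fun x => ∑ k ∈ a.support, a k * (lpDilate p ρ k x : ℂ) with hg
  have hval : ∀ k : ℤ, ∀ x ∈ frequencyAnnulus d k,
      ‖a k‖ₑ * 2 ^ (3 * d * k / p' : ℝ) ≤ ‖g x‖ₑ := by
    intro k x hx
    have hgx : g x = a k * ((2 ^ (3 * d * k / p' : ℝ) : ℝ) : ℂ) := by
      rw [hg, fourierIntegralFun_sum _ _ (fun i => integrable_lpDilate hρ i)]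
      simp only [fourierIntegralFun_lpDilate]
      rw [Finset.sum_eq_single k]
      · rw [h1 _ hx.1 hx.2, mul_one, hp'inv, mul_one_div]
      · intro i _ hik
        rw [fourier_eq_zero_of_mem_frequencyAnnulus h0 hik hx, mul_zero, mul_zero]
      · intro hk
        rw [Finsupp.notMem_support_iff.1 hk, zero_mul]
    rw [hgx, enorm_mul, ← ofReal_norm (((2 ^ _ : ℝ) : ℂ)), Complex.norm_real,
      Real.norm_of_nonneg (by positivity), ENNReal.ofReal_two_rpow]
  -- Different `k` probe different dyadic places of `g^*`, so their total is a subsum of the dyadic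
  -- sum for the Lorentz functional.
  have hinj : Function.Injective fun k : ℤ => j - 3 * d * k - 1 := by
    intro k l hkl
    have hd' : (3 * d : ℤ) ≠ 0 := by positivity
    refine mul_left_cancel₀ hd' ?_
    simp only at hkl
    linarith
  calc ∑' k, ‖a k‖ₑ ^ p ≤ ∑' k : ℤ, ((2 : ℝ≥0∞) ^ (-((j - 1) / p') : ℝ)) ^ p *
        (2 ^ (((j - 3 * d * k - 1 : ℤ) : ℝ) / p') *
          rearrangement volume g (2 ^ ((j - 3 * d * k - 1) + 1))) ^ p := by
        refine ENNReal.tsum_le_tsum fun k => ?_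
        rw [← ENNReal.mul_rpow_of_nonneg _ _ hp0.le, ← mul_assoc, ← ENNReal.two_rpow_add,
          sub_add_cancel]
        gcongr
        calc ‖a k‖ₑ = 2 ^ (-((j - 1) / p') + ((j - 3 * d * k - 1 : ℤ) : ℝ) / p' : ℝ) *
              (‖a k‖ₑ * 2 ^ (3 * d * k / p' : ℝ)) := by
              rw [mul_left_comm, ← ENNReal.two_rpow_add]
              have : (-((j - 1) / p') + ((j - 3 * d * k - 1 : ℤ) : ℝ) / p' + 3 * d * k / p' : ℝ)
                  = 0 := by
                push_cast; ring
              rw [this, ENNReal.rpow_zero, mul_one]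
          _ ≤ _ := by
              gcongr
              exact le_rearrangement_of_lt_measure (hval k) (hj k)
    _ = ((2 : ℝ≥0∞) ^ (-((j - 1) / p') : ℝ)) ^ p *
          ∑' k : ℤ, (fun i : ℤ => (2 ^ ((i : ℝ) / p') *
            rearrangement volume g (2 ^ (i + 1))) ^ p) (j - 3 * d * k - 1) :=
        ENNReal.tsum_mul_left
    _ ≤ _ := by
        rw [mul_assoc]
        gcongr
        exact (ENNReal.tsum_comp_le_tsum_of_injective hinj _).trans
          (tsum_dyadic_le_lorentzENorm_rpow hp'0 hp0 g)

end Dilates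

/-! ### The family of dilates and the conclusion. -/

section Main

lemma Lp_coeFn_sum_smul {α ι : Type*} [MeasurableSpace α] {μ : Measure α} {q : ℝ≥0∞}
    {v : ι → Lp ℂ q μ} {f : ι → α → ℂ} (hv : ∀ i, v i =ᵐ[μ] f i) (a : ι → ℂ) (s : Finset ι) :
    (∑ i ∈ s, a i • v i : Lp ℂ q μ) =ᵐ[μ] fun x => ∑ i ∈ s, a i * f i x := by
  classical
  induction s using Finset.induction_on with
  | empty =>
    simp only [Finset.sum_empty]
    exact Lp.coeFn_zero _ _ _
  | insert i s hi ih =>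
    rw [Finset.sum_insert hi]
    filter_upwards [ih, hv i, Lp.coeFn_add (a i • v i) (∑ j ∈ s, a j • v j),
      Lp.coeFn_smul (a i) (v i)] with x h1 h2 h3 h4
    rw [h3, Pi.add_apply, h4, h1, Pi.smul_apply, h2, smul_eq_mul, Finset.sum_insert hi]

variable {d : ℕ}

lemma coeFn_realToComplexLp {p : ℝ≥0∞} [Fact (1 ≤ p)]
    (u : Lp ℝ p (volume : Measure (EuclideanSpace ℝ (Fin d)))) :
    realToComplexLp d p u =ᵐ[volume] fun x => (u x : ℂ) :=
  Complex.ofRealCLM.coeFn_compLpL u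

lemma norm_realToComplexLp {p : ℝ≥0∞} [Fact (1 ≤ p)]
    (u : Lp ℝ p (volume : Measure (EuclideanSpace ℝ (Fin d)))) :
    ‖realToComplexLp d p u‖ = ‖u‖ := by
  rw [Lp.norm_def, Lp.norm_def]
  congr 1
  refine eLpNorm_congr_norm_ae ?_
  filter_upwards [coeFn_realToComplexLp u] with x hx
  rw [hx, Complex.norm_real]

/-- There is an infinite family of real functions in `L^p` on whose (complex) span the Fourier
transform into `L^{p',p}` is bounded below. -/
lemma exists_family_norm_le_fourier (hd : 1 ≤ d) {p p' : ℝ} (hp1 : 1 < p)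
    (hpp' : p.HolderConjugate p') [Fact (1 ≤ ENNReal.ofReal p)]
    {T : Lp ℂ (ENNReal.ofReal p) (volume : Measure (EuclideanSpace ℝ (Fin d))) →ₗ[ℂ]
      lorentzSpace (volume : Measure (EuclideanSpace ℝ (Fin d))) hpp'.symm.pos hpp'.pos}
    (hT : IsFourierTransform T) :
    ∃ u : ℤ → Lp ℝ (ENNReal.ofReal p) (volume : Measure (EuclideanSpace ℝ (Fin d))),
      LinearIndependent ℂ (fun k => realToComplexLp d (ENNReal.ofReal p) (u k)) ∧
      ∃ M : ℝ, 0 ≤ M ∧ ∀ x ∈ Submodule.span ℂ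
        (range fun k => realToComplexLp d (ENNReal.ofReal p) (u k)), ‖x‖ ≤ M * ‖T x‖ := by
  have hp0 : 0 < p := hpp'.pos
  obtain ⟨ρ, C, hC, hcont, hρi, hb0, hb1, hF1, hF0⟩ :=
    exists_real_fourier_annulus (V := EuclideanSpace ℝ (Fin d)) (2 * d)
  obtain ⟨M₁, hM₁, hup⟩ := exists_lintegral_sum_lpDilate_le hd hp1 hb0 hb1
  obtain ⟨M₂, hM₂, hlow⟩ := exists_tsum_le_lorentzENorm_fourier_sum hd hpp' hρi hF1 hF0
  have hfin : ∀ a : ℤ →₀ ℂ, ∑' k, ‖a k‖ₑ ^ p ≠ ∞ := fun a => by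
    rw [tsum_eq_sum (s := a.support) fun k hk => by
      rw [Finsupp.notMem_support_iff.1 hk, enorm_zero, ENNReal.zero_rpow_of_pos hp0]]
    exact ENNReal.sum_ne_top.2 fun k _ => ENNReal.rpow_ne_top_of_nonneg hp0.le enorm_ne_top
  have hmem : ∀ k, MemLp (lpDilate p ρ k) (ENNReal.ofReal p) volume := fun k => by
    refine ⟨(continuous_lpDilate hcont k).aestronglyMeasurable, ?_⟩
    rw [eLpNorm_lt_top_iff_lintegral_rpow_enorm_lt_top (by simpa using hp0) (by simp),
      ENNReal.toReal_ofReal hp0.le]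
    -- Membership in `L^p` is the upper estimate for a single coefficient equal to `1`.
    refine lt_of_le_of_lt ?_ ((hup (Finsupp.single k 1)).trans_lt
      (ENNReal.mul_lt_top hM₁.lt_top (hfin _).lt_top))
    refine lintegral_mono fun x => ?_
    rw [Finsupp.support_single, Finset.sum_singleton, Finsupp.single_eq_same,
      one_mul, ← ofReal_norm (lpDilate p ρ k x : ℂ), Complex.norm_real, ofReal_norm]
    exact one_ne_zero
  set v := fun k => realToComplexLp d (ENNReal.ofReal p) ((hmem k).toLp _) with hv
  have hvc : ∀ k, v k =ᵐ[volume] fun x => (lpDilate p ρ k x : ℂ) := fun k => by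
    filter_upwards [coeFn_realToComplexLp ((hmem k).toLp _), (hmem k).coeFn_toLp] with x h1 h2
    rw [hv, h1, h2]
  have hcoe : ∀ a : ℤ →₀ ℂ, (Finsupp.linearCombination ℂ v a : Lp ℂ (ENNReal.ofReal p) _)
      =ᵐ[volume] fun x => ∑ k ∈ a.support, a k * (lpDilate p ρ k x : ℂ) := fun a => by
    rw [Finsupp.linearCombination_apply]
    exact Lp_coeFn_sum_smul hvc a a.support
  have hTc : ∀ a : ℤ →₀ ℂ, ∑' k, ‖a k‖ₑ ^ p ≤ M₂ * lorentzENorm volume p' p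
      (T (Finsupp.linearCombination ℂ v a) : EuclideanSpace ℝ (Fin d) →ₘ[volume] ℂ) ^ p := by
    intro a
    have hi : Integrable (Finsupp.linearCombination ℂ v a : Lp ℂ (ENNReal.ofReal p) _) volume :=
      (integrable_finsetSum _ fun k _ => (integrable_lpDilate hρi k).const_mul (a k)).congr
        (hcoe a).symm
    rw [lorentzENorm_congr _ _ (hT.eq_integral _ hi), fourierIntegralFun_congr (hcoe a)]
    exact hlow a
  have hnorm : ∀ a : ℤ →₀ ℂ, ‖Finsupp.linearCombination ℂ v a‖ₑ ^ p ≤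
      M₁ * ∑' k, ‖a k‖ₑ ^ p := fun a => by
    rw [← lintegral_enorm_rpow_Lp_eq hp0, ← ENNReal.rpow_mul, one_div_mul_cancel hp0.ne',
      ENNReal.rpow_one]
    refine le_trans (le_of_eq (lintegral_congr_ae ?_)) (hup a)
    filter_upwards [hcoe a] with x hx
    rw [hx]
  refine ⟨fun k => (hmem k).toLp _, ?_, ((M₁ * M₂) ^ (1 / p)).toReal, ENNReal.toReal_nonneg, ?_⟩
  -- If a combination vanishes, boundedness makes the Lorentz functional of its image `0`, and the
  -- lower estimate kills every coefficient.
  · rw [linearIndependent_iff]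
    intro a ha
    have hz : lorentzENorm volume p' p (T (Finsupp.linearCombination ℂ v a) :
        EuclideanSpace ℝ (Fin d) →ₘ[volume] ℂ) = 0 := by
      obtain ⟨C', hC'⟩ := hT.bounded
      have h1 : ‖T (Finsupp.linearCombination ℂ v a)‖ ≤ 0 := by
        have := hC' (Finsupp.linearCombination ℂ v a)
        rwa [show ‖Finsupp.linearCombination ℂ v a‖ = 0 from by rw [norm_eq_zero]; exact ha,
          mul_zero] at this
      have h2 : (lorentzENorm volume p' p (T (Finsupp.linearCombination ℂ v a) :
        EuclideanSpace ℝ (Fin d) →ₘ[volume] ℂ)).toReal = 0 :=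
        le_antisymm h1 ENNReal.toReal_nonneg
      exact ((ENNReal.toReal_eq_zero_iff _).1 h2).resolve_right
        (ne_of_lt (T (Finsupp.linearCombination ℂ v a)).2)
    have h0 := hTc a
    rw [hz, ENNReal.zero_rpow_of_pos hp0, mul_zero, nonpos_iff_eq_zero, ENNReal.tsum_eq_zero] at h0
    ext k
    have := (ENNReal.rpow_eq_zero_iff_of_pos hp0).1 (h0 k)
    simpa using this
  · intro x hx
    obtain ⟨a, rfl⟩ := (Finsupp.mem_span_range_iff_exists_finsupp).1 hx
    change ‖Finsupp.linearCombination ℂ v a‖ ≤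
      _ * (lorentzENorm volume p' p (T (Finsupp.linearCombination ℂ v a) :
        EuclideanSpace ℝ (Fin d) →ₘ[volume] ℂ)).toReal
    have hne : lorentzENorm volume p' p (T (Finsupp.linearCombination ℂ v a) :
        EuclideanSpace ℝ (Fin d) →ₘ[volume] ℂ) ≠ ∞ :=
      ne_of_lt (T (Finsupp.linearCombination ℂ v a)).2
    rw [← ENNReal.toReal_mul, ← toReal_enorm]
    refine ENNReal.toReal_mono (by finiteness) ?_
    refine (ENNReal.rpow_le_rpow_iff hp0).1 ?_
    rw [ENNReal.mul_rpow_of_nonneg _ _ hp0.le, ← ENNReal.rpow_mul, one_div_mul_cancel hp0.ne',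
      ENNReal.rpow_one, mul_assoc]
    refine (hnorm a).trans ?_
    gcongr
    exact hTc a

end Main

theorem theorem3p2 (d : ℕ) (hd : 1 ≤ d) (p p' : ℝ) (hp1 : 1 < p) (hp2 : p < 2)
    (hpp' : p.HolderConjugate p') [Fact (1 ≤ ENNReal.ofReal p)] :
    ∃ T : Lp ℂ (ENNReal.ofReal p) (volume : Measure (EuclideanSpace ℝ (Fin d))) →ₗ[ℂ]
        lorentzSpace (volume : Measure (EuclideanSpace ℝ (Fin d))) hpp'.symm.pos hpp'.pos,
      IsFourierTransform T ∧
      -- complex scalars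
      ¬ IsStrictlySingular T ∧
      -- real scalars, on the space of real-valued functions
      ¬ IsStrictlySingular
        ((T.restrictScalars ℝ) ∘ₗ realToComplexLp d (ENNReal.ofReal p)) := by
  obtain ⟨T, hT⟩ := exists_fourierOperator d hp1 hp2 hpp'
  obtain ⟨C, hC⟩ := hT.bounded
  have hC' : ∀ x, ‖T x‖ ≤ |C| * ‖x‖ := fun x =>
    (hC x).trans (mul_le_mul_of_nonneg_right (le_abs_self C) (norm_nonneg x))
  obtain ⟨K, hK, hadd⟩ := exists_norm_add_le_lorentzSpace
    (volume : Measure (EuclideanSpace ℝ (Fin d))) hpp'.symm.pos hpp'.pos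
  obtain ⟨u, hu, M, hM, hb⟩ := exists_family_norm_le_fourier hd hp1 hpp' hT
  refine ⟨T, hT, not_isStrictlySingular_of_bounded_below (abs_nonneg C) hK hM hC' hadd hu hb, ?_⟩
  have hu' : LinearIndependent ℝ u :=
    LinearIndependent.of_comp (realToComplexLp d (ENNReal.ofReal p)) (hu.restrict_scalars' ℝ)
  refine not_isStrictlySingular_of_bounded_below (abs_nonneg C) hK hM (fun x => ?_) hadd hu'
    fun x hx => ?_
  · rw [← norm_realToComplexLp x]
    exact hC' _
  · rw [← norm_realToComplexLp x]
    -- The inclusion into complex functions is isometric and maps the real span into the complex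
    -- span, so the complex lower bound applies.
    refine hb _ (Submodule.span_le_restrictScalars ℝ ℂ _ ?_)
    rw [range_comp' , ← Submodule.map_span]
    exact ⟨x, hx, rfl⟩
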